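/- Let $G$ be a discrete group and $A$ a $C^*$-algebra. A partial action $\alpha$ of $G$ on $A$ consists of closed two-sided ideals $D_s$ of $A$ and $*$-isomorphisms $\alpha_s\colon D_{s^{-1}}\to D_s$ ($s\in G$) such that $D_e=A$ and $\alpha_{st}$ extends $\alpha_s\circ\alpha_t$ (with domain $\alpha_t^{-1}(D_{s^{-1}})$) for all $s,t\in G$. Let $L_c$ be the $*$-algebra of finitely supported functions $f\colon G\to A$ with $f(s)\in D_s$ for all $s$; writing $F(a,s)$ for the function with value $a\in D_s$ at $s$ and $0$ elsewhere, its operations are determined by \[ F(a,s)F(b,t)=F(\alpha_s(\alpha_s^{-1}(a)b),st),\qquad F(a,s)^*=F(\alpha_s^{-1}(a^*),s^{-1}). \] The crossed product $A\rtimes_\alpha G$ is the completion of $L_c$ in its greatest $C^*$-seminorm, and $A$ is mapped into it by $a\mapsto F(a,e)$. For a $C^*$-algebra $E$ we regard the multiplier algebra as $M(E)=\{x\in E^{**}: xE\cup Ex\subset E\}$, where $E^{**}$ is the double dual (enveloping von Neumann algebra) of $E$. For $s\in G$ let $p_s\in A^{**}$ be the identity of $D_s^{**}\subset A^{**}$,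 regarded also as an element of $(A\rtimes_\alpha G)^{**}$, and let $m_s$ be the unique element of $p_s(A\rtimes_\alpha G)^{**}p_{s^{-1}}$ such that $a\,m_s=F(a,s)$ for $a\in D_s$ and $m_s\,b=F(\alpha_s(b),s)$ for $b\in D_{s^{-1}}$. Fix a partial action $\alpha$ of $G$ on $A$ and $s\in G$, and consider the conditions (i) $p_s\in M(A)$; (ii) $D_s=Ap_s$; (iii) $M(D_s)\subset M(A)$ (as subsets of $A^{**}$); (iv) $m_s\in M(A\rtimes_\alpha G)$. Then (i), (ii) and (iii) are equivalent, and they are implied by (iv). Moreover, if $p_s\in M(A)$ and $p_{s^{-1}}\in M(A)$, then (iv) holds. -/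

import Mathlib

noncomputable section

/-- The double dual of a complex normed space. -/
abbrev Bidual (E : Type*) [NormedAddCommGroup E] [NormedSpace ℂ E] : Type _ :=
  StrongDual ℂ (StrongDual ℂ E)

namespace Bidual

section Maps

variable {E F : Type*} [NormedAddCommGroup E] [NormedSpace ℂ E]
  [NormedAddCommGroup F] [NormedSpace ℂ F]

/-- The canonical embedding of `E` in `E**`. -/
def ofElem (a : E) : Bidual E := NormedSpace.inclusionInDoubleDual ℂ E a

/-- The double transpose `T** : E** → F**` of a bounded operator `T : E → F`. -/
def map (T : E →L[ℂ] F) (x : Bidual E) : Bidual F :=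
  x.comp ((ContinuousLinearMap.compL ℂ E F ℂ).flip T)

@[simp] lemma ofElem_apply (a : E) (φ : StrongDual ℂ E) : ofElem a φ = φ a := rfl

@[simp] lemma map_apply (T : E →L[ℂ] F) (x : Bidual E) (φ : StrongDual ℂ F) :
    map T x φ = x (φ.comp T) := rfl

end Maps

section Arens

variable {E : Type*} [NonUnitalNormedRing E] [NormedSpace ℂ E]
  [IsScalarTower ℂ E E] [SMulCommClass ℂ E E]

/-- For `φ ∈ E*`, the map `E → E*`, `a ↦ φ · a`, where `(φ · a)(b) = φ (a b)`. -/
def actRight : StrongDual ℂ E →L[ℂ] E →L[ℂ] StrongDual ℂ E :=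
  ((ContinuousLinearMap.compL ℂ E (E →L[ℂ] E) (StrongDual ℂ E)).flip
    (ContinuousLinearMap.mul ℂ E)).comp (ContinuousLinearMap.compL ℂ E E ℂ)

/-- For `y ∈ E**` and `φ ∈ E*`, the functional `y · φ ∈ E*`, `(y · φ)(a) = y (φ · a)`. -/
def actLeft (y : Bidual E) : StrongDual ℂ E →L[ℂ] StrongDual ℂ E :=
  (ContinuousLinearMap.compL ℂ E (StrongDual ℂ E) ℂ y).comp actRight

/-- The (first) Arens product on `E**`: `(x y)(φ) = x (y · φ)`. -/
def mul (x y : Bidual E) : Bidual E := x.comp (actLeft y)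

@[simp] lemma actRight_apply (φ : StrongDual ℂ E) (a b : E) : actRight φ a b = φ (a * b) := rfl

@[simp] lemma actLeft_apply (y : Bidual E) (φ : StrongDual ℂ E) (a : E) :
    actLeft y φ a = y (actRight φ a) := rfl

@[simp] lemma mul_apply (x y : Bidual E) (φ : StrongDual ℂ E) : mul x y φ = x (actLeft y φ) := rfl

end Arens

section One

variable {E : Type*} [NonUnitalCStarAlgebra E]

open Filter Topology

lemma exists_rotate (z : ℂ) : ∃ c : ℂ, ‖c‖ = 1 ∧ c * z = (‖z‖ : ℂ) := by
  by_cases hz : z = 0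
  · exact ⟨1, by simp, by simp [hz]⟩
  · have hz' : (‖z‖ : ℂ) ≠ 0 := by simpa using hz
    refine ⟨(‖z‖ : ℂ) / z, by simp [hz], by field_simp⟩

lemma norm_functional_sub_le (φ : StrongDual ℂ E) {t : ℝ} (ht : 0 < t) :
    ∃ b : E, ‖b‖ ≤ 1 ∧ ∀ x : E, ‖x‖ ≤ 1 → ‖star b - star b * x‖ ≤ t →
      ‖φ - actRight φ x‖ ≤ (1 + 3 * ‖φ‖) * t := by
  obtain ⟨b₀, hb₀, hb₀'⟩ : ∃ b : E, ‖b‖ ≤ 1 ∧ ‖φ‖ - t ^ 2 < ‖φ b‖ := by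
    by_contra! h
    have h0 : 0 ≤ ‖φ‖ - t ^ 2 := (norm_nonneg _).trans (h 0 (by simp))
    have := ContinuousLinearMap.opNorm_le_of_unit_norm (f := φ) h0 (fun x hx => h x hx.le)
    nlinarith [sq_pos_of_pos ht]
  obtain ⟨c, hc, hcb⟩ := exists_rotate (φ b₀)
  refine ⟨c • b₀, by simpa [norm_smul, hc] using hb₀, fun x hx hbx => ?_⟩
  set b := c • b₀ with hb
  have hb1 : ‖b‖ ≤ 1 := by simpa [hb, norm_smul, hc] using hb₀
  have hφb : φ b = (‖φ b₀‖ : ℂ) := by simp [hb, hcb]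
  refine ContinuousLinearMap.opNorm_le_of_unit_norm (by positivity) fun z₀ hz₀ => ?_
  obtain ⟨d, hd, hdz⟩ := exists_rotate ((φ - actRight φ x) z₀)
  set z := d • z₀ with hz
  have hz1 : ‖z‖ = 1 := by simp [hz, norm_smul, hd, hz₀]
  set w := z - x * z with hw
  have hφw : φ w = (‖(φ - actRight φ x) z₀‖ : ℂ) := by
    rw [← hdz, hw, hz]
    simp [mul_sub, mul_smul_comm]
  have hw2 : ‖w‖ ≤ 2 := by
    calc ‖w‖ ≤ ‖z‖ + ‖x * z‖ := norm_sub_le _ _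
      _ ≤ ‖z‖ + ‖x‖ * ‖z‖ := by gcongr; exact norm_mul_le _ _
      _ ≤ 2 := by rw [hz1]; linarith
  have hbw : ‖star b * w‖ ≤ t := by
    have : star b * w = (star b - star b * x) * z := by rw [hw, mul_sub, sub_mul, mul_assoc]
    rw [this]
    refine (norm_mul_le _ _).trans ?_
    rw [hz1, mul_one]; exact hbx
  have hwb : ‖star w * b‖ ≤ t := by
    rw [← norm_star, star_mul, star_star]; exact hbw
  set y := b + (t : ℂ) • w with hy
  have hyy : ‖y‖ ^ 2 ≤ 1 + 2 * t * t + 4 * t ^ 2 := by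
    have e : star y * y = star b * b + (t : ℂ) • (star b * w) + (t : ℂ) • (star w * b)
        + (t : ℂ) • (t : ℂ) • (star w * w) := by
      simp only [hy, star_add, star_smul, Complex.star_def, Complex.conj_ofReal, add_mul, mul_add,
        smul_mul_assoc, mul_smul_comm, smul_add]
      abel
    rw [sq, ← CStarRing.norm_star_mul_self, e]
    have h1 : ‖star b * b‖ ≤ 1 := by
      rw [CStarRing.norm_star_mul_self]; nlinarith [norm_nonneg b]
    have h2 : ‖star w * w‖ ≤ 4 := by
      rw [CStarRing.norm_star_mul_self]; nlinarith [norm_nonneg w]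
    have ht' : ‖(t : ℂ)‖ = t := by simp [abs_of_pos ht]
    calc _ ≤ ‖star b * b‖ + ‖(t : ℂ) • (star b * w)‖ + ‖(t : ℂ) • (star w * b)‖
        + ‖(t : ℂ) • (t : ℂ) • (star w * w)‖ := norm_add₄_le
      _ = ‖star b * b‖ + t * ‖star b * w‖ + t * ‖star w * b‖ + t * (t * ‖star w * w‖) := by
        simp only [norm_smul, ht']
      _ ≤ 1 + t * t + t * t + t * (t * 4) := by gcongr
      _ = _ := by ring
  have hy1 : ‖y‖ ≤ 1 + 3 * t ^ 2 := by
    refine le_of_sq_le_sq ?_ (by positivity)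
    nlinarith [sq_nonneg (t ^ 2)]
  have hφy : φ y = ((‖φ b₀‖ + t * ‖(φ - actRight φ x) z₀‖ : ℝ) : ℂ) := by
    simp [hy, hφb, hφw]
  have hle : ‖φ b₀‖ + t * ‖(φ - actRight φ x) z₀‖ ≤ ‖φ‖ * (1 + 3 * t ^ 2) := by
    have := (φ.le_opNorm y).trans (mul_le_mul_of_nonneg_left hy1 (norm_nonneg _))
    rw [hφy, Complex.norm_real] at this
    exact (le_abs_self _).trans this
  have : t * ‖(φ - actRight φ x) z₀‖ ≤ t * ((1 + 3 * ‖φ‖) * t) := by nlinarith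
  exact le_of_mul_le_mul_left this ht

variable (E) in
/-- The double dual of a C⋆-algebra has an identity. -/
theorem exists_one : ∃ e : Bidual E, ∀ x : Bidual E, mul e x = x ∧ mul x e = x := by
  let _ : PartialOrder E := CStarAlgebra.spectralOrder E
  have _ : StarOrderedRing E := CStarAlgebra.spectralOrderedRing E
  have hl := CStarAlgebra.increasingApproximateUnit E
  have _ := hl.neBot
  let u := Ultrafilter.of (CStarAlgebra.approximateUnit E)
  have hu : (u : Filter E) ≤ CStarAlgebra.approximateUnit E := Ultrafilter.of_le _
  have hconv : ∀ φ : StrongDual ℂ E,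
      Tendsto (fun x => actRight φ x) (CStarAlgebra.approximateUnit E) (𝓝 φ) := by
    intro φ
    rw [Metric.tendsto_nhds]
    intro ε hε
    have hpos : 0 < 1 + 3 * ‖φ‖ := by positivity
    obtain ⟨b, -, hb⟩ := norm_functional_sub_le φ (t := ε / 2 / (1 + 3 * ‖φ‖)) (by positivity)
    have h1 : ∀ᶠ x in CStarAlgebra.approximateUnit E, ‖x‖ ≤ 1 := hl.eventually_norm
    have h2 := Metric.tendsto_nhds.1 (hl.tendsto_mul_left (star b)) (ε / 2 / (1 + 3 * ‖φ‖))
      (by positivity)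
    filter_upwards [h1, h2] with x hx1 hx2
    rw [dist_comm, dist_eq_norm]
    rw [dist_comm, dist_eq_norm] at hx2
    have := hb x hx1 hx2.le
    rw [mul_div_cancel₀ _ hpos.ne'] at this
    linarith
  obtain ⟨e, he⟩ : ∃ e : Bidual E, ∀ φ : StrongDual ℂ E, Tendsto (fun x => φ x) u (𝓝 (e φ)) := by
    let i : E → WeakDual ℂ (StrongDual ℂ E) := fun a => StrongDual.toWeakDual (ofElem a)
    have hK := WeakDual.isCompact_closedBall (𝕜 := ℂ) (E := StrongDual ℂ E) 0 1
    have hmem : ∀ᶠ x in (u : Filter E), i x ∈ WeakDual.toStrongDual ⁻¹'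
        Metric.closedBall (0 : StrongDual ℂ (StrongDual ℂ E)) 1 := by
      filter_upwards [hu hl.eventually_norm] with x hx
      have h : ‖ofElem x‖ ≤ 1 := (NormedSpace.double_dual_bound ℂ E x).trans hx
      exact (dist_eq_norm (ofElem x) 0).trans_le ((congrArg norm (sub_zero (ofElem x))).trans_le h)
    obtain ⟨e, -, he⟩ := hK.ultrafilter_le_nhds (u.map i) (by
      rw [le_principal_iff]; exact hmem)
    refine ⟨WeakDual.toStrongDual e, fun φ => ?_⟩
    exact ((WeakDual.eval_continuous φ).tendsto e).comp (show Tendsto i u (𝓝 e) from he)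
  refine ⟨e, fun x => ⟨?_, ?_⟩⟩
  · ext φ
    refine tendsto_nhds_unique (he (actLeft x φ)) ?_
    exact (x.continuous.tendsto φ).comp ((hconv φ).mono_left hu)
  · ext φ
    have : actLeft e φ = φ := by
      ext a
      refine tendsto_nhds_unique (he (actRight φ a)) ?_
      exact (φ.continuous.tendsto a).comp ((hl.tendsto_mul_left a).mono_left hu)
    rw [mul_apply, this]

variable (E) in
/-- The identity of the double dual of a C⋆-algebra. -/
def one : Bidual E := (exists_one E).choose

lemma one_mul (x : Bidual E) : mul (one E) x = x := ((exists_one E).choose_spec x).1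

lemma mul_one (x : Bidual E) : mul x (one E) = x := ((exists_one E).choose_spec x).2

end One

end Bidual

/-- A C⋆-seminorm on a complex ⋆-algebra. -/
structure CStarSeminorm (L : Type*) [NonUnitalRing L] [Module ℂ L] [StarRing L] extends
    Seminorm ℂ L where
  mul_le : ∀ x y : L, toSeminorm (x * y) ≤ toSeminorm x * toSeminorm y
  star_mul_self : ∀ x : L, toSeminorm (star x * x) = toSeminorm x ^ 2

namespace CStarSeminorm

variable {L : Type*} [NonUnitalRing L] [Module ℂ L] [StarRing L]

lemma apply_star (p : CStarSeminorm L) (x : L) : p.toSeminorm (star x) = p.toSeminorm x := by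
  have key : ∀ y : L, p.toSeminorm y ≤ p.toSeminorm (star y) := by
    intro y
    have h := p.mul_le (star y) y
    rw [p.star_mul_self] at h
    rcases (apply_nonneg p.toSeminorm y).eq_or_lt with h0 | h0
    · rw [← h0]; exact apply_nonneg _ _
    · exact le_of_mul_le_mul_right (by rwa [sq] at h) h0
  refine le_antisymm ?_ (key x)
  simpa using key (star x)

/-- The ⋆-algebra `L`, endowed with the C⋆-seminorm `p`. -/
@[nolint unusedArguments]
def Pre (_ : CStarSeminorm L) : Type _ := L

variable (p : CStarSeminorm L)

instance : NonUnitalRing p.Pre := inferInstanceAs (NonUnitalRing L)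
instance : Module ℂ p.Pre := inferInstanceAs (Module ℂ L)
instance : StarRing p.Pre := inferInstanceAs (StarRing L)
instance [StarModule ℂ L] : StarModule ℂ p.Pre := inferInstanceAs (StarModule ℂ L)
instance [IsScalarTower ℂ L L] : IsScalarTower ℂ p.Pre p.Pre :=
  inferInstanceAs (IsScalarTower ℂ L L)
instance [SMulCommClass ℂ L L] : SMulCommClass ℂ p.Pre p.Pre :=
  inferInstanceAs (SMulCommClass ℂ L L)

instance : SeminormedAddCommGroup p.Pre :=
  { AddGroupSeminorm.toSeminormedAddCommGroup
      (show AddGroupSeminorm p.Pre from p.toSeminorm.toAddGroupSeminorm) with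
    toAddCommGroup := NonUnitalNonAssocRing.toAddCommGroup }

lemma norm_pre (x : p.Pre) : ‖x‖ = p.toSeminorm (show L from x) := rfl

instance : NonUnitalSeminormedRing p.Pre where
  dist_eq := SeminormedAddCommGroup.dist_eq
  norm_mul_le x y := p.mul_le x y

instance : NormedSpace ℂ p.Pre where
  norm_smul_le c x := (map_smul_eq_mul p.toSeminorm c (show L from x)).le

instance : NormedStarGroup p.Pre where
  norm_star_le x := (p.apply_star x).le

/-- The Hausdorff completion of `L` with respect to the C⋆-seminorm `p`. -/
def Completion : Type _ := UniformSpace.Completion p.Pre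

namespace Completion

open UniformSpace

instance : NormedAddCommGroup p.Completion :=
  inferInstanceAs (NormedAddCommGroup (UniformSpace.Completion p.Pre))
instance : NormedSpace ℂ p.Completion :=
  inferInstanceAs (NormedSpace ℂ (UniformSpace.Completion p.Pre))
instance : CompleteSpace p.Completion :=
  inferInstanceAs (CompleteSpace (UniformSpace.Completion p.Pre))

/-- The canonical map of `L` into its completion. -/
def of : L →ₗ[ℂ] p.Completion where
  toFun x := ((show p.Pre from x) : UniformSpace.Completion p.Pre)
  map_add' x y := UniformSpace.Completion.coe_add (α := p.Pre) x y
  map_smul' c x := UniformSpace.Completion.coe_smul c (show p.Pre from x)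

lemma norm_of (x : L) : ‖of p x‖ = p.toSeminorm x :=
  UniformSpace.Completion.norm_coe (show p.Pre from x)

lemma denseRange_of : DenseRange (of p) :=
  UniformSpace.Completion.denseRange_coe (α := p.Pre)

lemma isDenseInducing_of : IsDenseInducing (fun x : p.Pre => of p x) :=
  UniformSpace.Completion.isDenseInducing_coe (α := p.Pre)

/-- The multiplication of the completion: the continuous extension of that of `L`. -/
instance : Mul p.Completion where
  mul x y := ((isDenseInducing_of p).prodMap (isDenseInducing_of p)).extend
    (fun q : p.Pre × p.Pre => of p (q.1 * q.2)) (x, y)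

/-- The involution of the completion: the continuous extension of that of `L`. -/
instance : Star p.Completion where
  star x := UniformSpace.Completion.map (star : p.Pre → p.Pre) x

lemma continuous_of : Continuous (fun x : p.Pre => of p x) := (isDenseInducing_of p).continuous

lemma of_mul (x y : L) : of p (x * y) = of p x * of p y :=
  (((isDenseInducing_of p).prodMap (isDenseInducing_of p)).extend_eq
    (f := fun q : p.Pre × p.Pre => of p (q.1 * q.2))
    ((continuous_of p).comp continuous_mul) (x, y)).symm

lemma isometry_star_pre : Isometry (star : p.Pre → p.Pre) :=
  AddMonoidHomClass.isometry_of_norm (starAddEquiv : p.Pre ≃+ p.Pre) fun x => p.apply_star x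

lemma of_star (x : L) : of p (star x) = star (of p x) :=
  (UniformSpace.Completion.map_coe (isometry_star_pre p).uniformContinuous
    (show p.Pre from x)).symm

instance : ContinuousMul p.Completion where
  continuous_mul := by
    let t : p.Pre →+ p.Completion := (of p).toAddMonoidHom
    let m : p.Pre →+ p.Pre →+ p.Completion := (AddMonoidHom.mul : p.Pre →+ p.Pre →+ p.Pre).compr₂ t
    have hm : Continuous fun q : p.Pre × p.Pre => m q.1 q.2 := (continuous_of p).comp continuous_mul
    have di : IsDenseInducing t := isDenseInducing_of p
    exact (di.extend_Z_bilin di hm :)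

instance : ContinuousStar p.Completion where
  continuous_star := UniformSpace.Completion.continuous_map (f := (star : p.Pre → p.Pre))

lemma ind {P : p.Completion → Prop} (hP : IsClosed {x | P x}) (h : ∀ a, P (of p a)) (x) : P x :=
  UniformSpace.Completion.induction_on (α := p.Pre) x hP h

lemma ind₂ {P : p.Completion → p.Completion → Prop}
    (hP : IsClosed {x : p.Completion × p.Completion | P x.1 x.2})
    (h : ∀ a b, P (of p a) (of p b)) (x y) : P x y :=
  UniformSpace.Completion.induction_on₂ (α := p.Pre) (β := p.Pre) x y hP h

lemma ind₃ {P : p.Completion → p.Completion → p.Completion → Prop}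
    (hP : IsClosed {x : p.Completion × p.Completion × p.Completion | P x.1 x.2.1 x.2.2})
    (h : ∀ a b c, P (of p a) (of p b) (of p c)) (x y z) : P x y z :=
  UniformSpace.Completion.induction_on₃ (α := p.Pre) (β := p.Pre) (γ := p.Pre) x y z hP h

lemma left_distrib' (x y z : p.Completion) : x * (y + z) = x * y + x * z :=
  ind₃ p (P := fun x y z => x * (y + z) = x * y + x * z)
    (isClosed_eq (by fun_prop) (by fun_prop))
    (fun a b c => by simp only [← of_mul, ← map_add, mul_add]) x y z

lemma right_distrib' (x y z : p.Completion) : (x + y) * z = x * z + y * z :=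
  ind₃ p (P := fun x y z => (x + y) * z = x * z + y * z)
    (isClosed_eq (by fun_prop) (by fun_prop))
    (fun a b c => by simp only [← of_mul, ← map_add, add_mul]) x y z

lemma mul_assoc' (x y z : p.Completion) : x * y * z = x * (y * z) :=
  ind₃ p (P := fun x y z => x * y * z = x * (y * z))
    (isClosed_eq (by fun_prop) (by fun_prop))
    (fun a b c => by simp only [← of_mul, mul_assoc]) x y z

lemma norm_mul_le' (x y : p.Completion) : ‖x * y‖ ≤ ‖x‖ * ‖y‖ :=
  ind₂ p (P := fun x y => ‖x * y‖ ≤ ‖x‖ * ‖y‖)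
    (isClosed_le (by fun_prop) (by fun_prop))
    (fun a b => by rw [← of_mul, norm_of, norm_of, norm_of]; exact p.mul_le a b) x y

lemma star_star' (x : p.Completion) : star (star x) = x :=
  ind p (P := fun x => star (star x) = x) (isClosed_eq (by fun_prop) (by fun_prop))
    (fun a => by rw [← of_star, ← of_star, star_star]) x

lemma star_mul' (x y : p.Completion) : star (x * y) = star y * star x :=
  ind₂ p (P := fun x y => star (x * y) = star y * star x)
    (isClosed_eq (by fun_prop) (by fun_prop))
    (fun a b => by simp only [← of_mul, ← of_star, star_mul]) x y

lemma star_add' (x y : p.Completion) : star (x + y) = star x + star y :=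
  ind₂ p (P := fun x y => star (x + y) = star x + star y)
    (isClosed_eq (by fun_prop) (by fun_prop))
    (fun a b => by simp only [← of_star, ← map_add, star_add]) x y

lemma star_smul' [StarModule ℂ L] (c : ℂ) (x : p.Completion) : star (c • x) = star c • star x :=
  ind p (P := fun x => star (c • x) = star c • star x)
    (isClosed_eq (continuous_star.comp (continuous_const_smul c))
      ((continuous_const_smul (star c)).comp continuous_star))
    (fun a => by simp only [← of_star, ← map_smul, star_smul]) x

lemma norm_sq_le' (x : p.Completion) : ‖x‖ * ‖x‖ ≤ ‖star x * x‖ :=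
  ind p (P := fun x => ‖x‖ * ‖x‖ ≤ ‖star x * x‖)
    (isClosed_le (by fun_prop) (by fun_prop))
    (fun a => by rw [← of_star, ← of_mul, norm_of, norm_of, p.star_mul_self, sq]) x

lemma smul_mul' [IsScalarTower ℂ L L] (c : ℂ) (x y : p.Completion) : (c • x) * y = c • (x * y) :=
  ind₂ p (P := fun x y => (c • x) * y = c • (x * y))
    (isClosed_eq ((continuous_fst.const_smul c).mul continuous_snd)
      (continuous_mul.const_smul c))
    (fun a b => by simp only [← of_mul, ← map_smul, smul_mul_assoc]) x y

lemma mul_smul' [SMulCommClass ℂ L L] (c : ℂ) (x y : p.Completion) : x * (c • y) = c • (x * y) :=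
  ind₂ p (P := fun x y => x * (c • y) = c • (x * y))
    (isClosed_eq (continuous_fst.mul (continuous_snd.const_smul c))
      (continuous_mul.const_smul c))
    (fun a b => by simp only [← of_mul, ← map_smul, mul_smul_comm]) x y

instance : NonUnitalNormedRing p.Completion where
  dist_eq := NormedAddCommGroup.dist_eq
  left_distrib := left_distrib' p
  right_distrib := right_distrib' p
  mul_assoc := mul_assoc' p
  zero_mul x := by simpa using right_distrib' p 0 0 x
  mul_zero x := by simpa using left_distrib' p x 0 0
  norm_mul_le := norm_mul_le' p

instance : StarRing p.Completion where
  star_involutive := star_star' p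
  star_mul := star_mul' p
  star_add := star_add' p

/-- The completion of a complex ⋆-algebra with respect to a C⋆-seminorm is a C⋆-algebra. -/
instance [StarModule ℂ L] [IsScalarTower ℂ L L] [SMulCommClass ℂ L L] :
    NonUnitalCStarAlgebra p.Completion where
  __ := (inferInstance : NormedSpace ℂ p.Completion)
  norm_mul_self_le := norm_sq_le' p
  smul_assoc := smul_mul' p
  smul_comm c x y := (mul_smul' p c x y).symm
  star_smul := star_smul' p

end Completion

/-- A C⋆-seminorm on a C⋆-algebra is dominated by the norm. -/
lemma le_norm {A : Type*} [NonUnitalCStarAlgebra A] (p : CStarSeminorm A) (a : A) :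
    p.toSeminorm a ≤ ‖a‖ := by
  let f : A →⋆ₙₐ[ℂ] p.Completion :=
    { Completion.of p with
      map_zero' := map_zero (Completion.of p)
      map_mul' := Completion.of_mul p
      map_star' := Completion.of_star p }
  have h := NonUnitalStarAlgHom.norm_apply_le f a
  rwa [show f a = Completion.of p a from rfl, Completion.norm_of] at h

instance : Nonempty (CStarSeminorm L) :=
  ⟨{ toSeminorm := 0
     mul_le := fun x y => by simp
     star_mul_self := fun x => by simp }⟩

/-- The greatest C⋆-seminorm, the pointwise supremum of all of them, in case it is finite. -/
def greatest (h : ∀ x, BddAbove (Set.range fun p : CStarSeminorm L => p.toSeminorm x)) :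
    CStarSeminorm L where
  toFun x := ⨆ p : CStarSeminorm L, p.toSeminorm x
  map_zero' := by simp
  add_le' x y := ciSup_le fun p => (map_add_le_add p.toSeminorm x y).trans
    (add_le_add (le_ciSup (h x) p) (le_ciSup (h y) p))
  neg' x := by simp
  smul' c x := by simp only [map_smul_eq_mul]; rw [Real.mul_iSup_of_nonneg (norm_nonneg c)]
  mul_le x y := ciSup_le fun p => (p.mul_le x y).trans
    (mul_le_mul (le_ciSup (h x) p) (le_ciSup (h y) p) (apply_nonneg _ _)
      ((apply_nonneg p.toSeminorm x).trans (le_ciSup (h x) p)))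
  star_mul_self x := by
    show (⨆ p : CStarSeminorm L, p.toSeminorm (star x * x)) =
      (⨆ p : CStarSeminorm L, p.toSeminorm x) ^ 2
    simp only [CStarSeminorm.star_mul_self]
    refine le_antisymm (ciSup_le fun p => ?_) ?_
    · exact pow_le_pow_left₀ (apply_nonneg _ _) (le_ciSup (h x) p) 2
    · have hb : BddAbove (Set.range fun p : CStarSeminorm L => p.toSeminorm x ^ 2) := by
        simpa only [CStarSeminorm.star_mul_self] using h (star x * x)
      have h0 : 0 ≤ ⨆ p : CStarSeminorm L, p.toSeminorm x ^ 2 :=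
        Real.iSup_nonneg fun p => sq_nonneg _
      have : (⨆ p : CStarSeminorm L, p.toSeminorm x) ≤
          √(⨆ p : CStarSeminorm L, p.toSeminorm x ^ 2) :=
        ciSup_le fun p => Real.le_sqrt_of_sq_le (le_ciSup hb p)
      calc _ ≤ √(⨆ p : CStarSeminorm L, p.toSeminorm x ^ 2) ^ 2 :=
            pow_le_pow_left₀ (Real.iSup_nonneg fun p => apply_nonneg _ _) this 2
        _ = _ := Real.sq_sqrt h0

lemma le_greatest (h : ∀ x, BddAbove (Set.range fun p : CStarSeminorm L => p.toSeminorm x))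
    (p : CStarSeminorm L) (x : L) : p.toSeminorm x ≤ (greatest h).toSeminorm x :=
  le_ciSup (h x) p

end CStarSeminorm

/-- A partial action of a (discrete) group `G` on a C⋆-algebra `A`: closed two-sided ideals `D s`
and ⋆-isomorphisms `α s : D s⁻¹ → D s` such that `D 1 = A` and `α (s * t)` extends `α s ∘ α t`. -/
structure PartialAction (G A : Type*) [Group G] [NonUnitalCStarAlgebra A] where
  D : G → NonUnitalStarSubalgebra ℂ A
  isClosed_D : ∀ s, IsClosed (D s : Set A)
  mul_mem_left : ∀ s (a : A) {b : A}, b ∈ D s → a * b ∈ D s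
  mul_mem_right : ∀ s {a : A} (b : A), a ∈ D s → a * b ∈ D s
  α : ∀ s, D s⁻¹ ≃⋆ₐ[ℂ] D s
  D_one : D 1 = ⊤
  extends_comp : ∀ (s t : G) (a : D t⁻¹) (h : (α t a : A) ∈ D s⁻¹),
    ∃ h' : (a : A) ∈ D (s * t)⁻¹, (α (s * t) ⟨a, h'⟩ : A) = α s ⟨α t a, h⟩

namespace PartialAction

variable {G A : Type*} [Group G] [NonUnitalCStarAlgebra A] (α : PartialAction G A)

instance (s : G) : IsClosed (α.D s : Set A) := α.isClosed_D s

variable {α} in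
lemma D_congr {s t : G} (h : s = t) {a : A} (ha : a ∈ α.D s) : a ∈ α.D t := h ▸ ha

open Classical in
/-- `α s`, extended by zero to all of `A` (an auxiliary notion that avoids subtypes). -/
def act (s : G) (a : A) : A := if h : a ∈ α.D s⁻¹ then (α.α s ⟨a, h⟩ : A) else 0

lemma act_of_mem {s : G} {a : A} (h : a ∈ α.D s⁻¹) : α.act s a = (α.α s ⟨a, h⟩ : A) := dif_pos h

lemma act_coe {s : G} (a : α.D s⁻¹) : α.act s a = (α.α s a : A) := α.act_of_mem a.2

lemma act_mem {s : G} {a : A} (h : a ∈ α.D s⁻¹) : α.act s a ∈ α.D s := by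
  rw [act_of_mem α h]; exact (α.α s _).2

lemma act_act {s t : G} {a : A} (h : a ∈ α.D t⁻¹) (h' : α.act t a ∈ α.D s⁻¹) :
    a ∈ α.D (s * t)⁻¹ ∧ α.act (s * t) a = α.act s (α.act t a) := by
  have e := α.act_of_mem h
  obtain ⟨h1, h2⟩ := α.extends_comp s t ⟨a, h⟩ (e ▸ h')
  refine ⟨h1, ?_⟩
  rw [α.act_of_mem h1, h2, α.act_of_mem h']
  congr 3
  exact e.symm

lemma mem_one (a : A) : a ∈ α.D 1 := by rw [α.D_one]; trivial

lemma act_injOn {s : G} {a b : A} (ha : a ∈ α.D s⁻¹) (hb : b ∈ α.D s⁻¹)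
    (h : α.act s a = α.act s b) : a = b := by
  rw [α.act_of_mem ha, α.act_of_mem hb] at h
  exact congrArg Subtype.val ((α.α s).injective (Subtype.ext h))

lemma act_one (a : A) : α.act 1 a = a := by
  have m : ∀ b : A, b ∈ α.D (1 : G)⁻¹ := fun b => by rw [inv_one]; exact α.mem_one b
  refine α.act_injOn (m _) (m _) ?_
  have := (α.act_act (s := 1) (t := 1) (m a) (m _)).2
  rw [one_mul] at this
  exact this.symm

lemma act_inv_act {s : G} {a : A} (h : a ∈ α.D s⁻¹) : α.act s⁻¹ (α.act s a) = a := by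
  have h' : α.act s a ∈ α.D (s⁻¹)⁻¹ := by rw [inv_inv]; exact α.act_mem h
  have := (α.act_act h h').2
  rw [inv_mul_cancel, act_one] at this
  exact this.symm

lemma act_act_inv {s : G} {a : A} (h : a ∈ α.D s) : α.act s (α.act s⁻¹ a) = a := by
  have := α.act_inv_act (s := s⁻¹) (a := a) (by rwa [inv_inv])
  rwa [inv_inv] at this

lemma act_inv_mem {s : G} {a : A} (h : a ∈ α.D s) : α.act s⁻¹ a ∈ α.D s⁻¹ :=
  α.act_mem (by rwa [inv_inv])

lemma coe_symm {s : G} (a : α.D s) : ((α.α s).symm a : A) = α.act s⁻¹ a := by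
  refine α.act_injOn (s := s) ((α.α s).symm a).2 (α.act_inv_mem a.2) ?_
  rw [α.act_act_inv a.2, act_coe, StarAlgEquiv.apply_symm_apply]

lemma act_mul {s : G} {a b : A} (ha : a ∈ α.D s⁻¹) (hb : b ∈ α.D s⁻¹) :
    α.act s (a * b) = α.act s a * α.act s b := by
  rw [α.act_of_mem ha, α.act_of_mem hb, α.act_of_mem (mul_mem ha hb)]
  exact congrArg Subtype.val (map_mul (α.α s) ⟨a, ha⟩ ⟨b, hb⟩)

lemma act_add {s : G} {a b : A} (ha : a ∈ α.D s⁻¹) (hb : b ∈ α.D s⁻¹) :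
    α.act s (a + b) = α.act s a + α.act s b := by
  rw [α.act_of_mem ha, α.act_of_mem hb, α.act_of_mem (add_mem ha hb)]
  exact congrArg Subtype.val (map_add (α.α s) ⟨a, ha⟩ ⟨b, hb⟩)

lemma act_smul {s : G} (c : ℂ) {a : A} (ha : a ∈ α.D s⁻¹) :
    α.act s (c • a) = c • α.act s a := by
  rw [α.act_of_mem ha, α.act_of_mem (SMulMemClass.smul_mem c ha)]
  exact congrArg Subtype.val (map_smul (α.α s) c ⟨a, ha⟩)

lemma act_star {s : G} {a : A} (ha : a ∈ α.D s⁻¹) : α.act s (star a) = star (α.act s a) := by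
  rw [α.act_of_mem ha, α.act_of_mem (star_mem ha)]
  exact congrArg Subtype.val (map_star (α.α s) ⟨a, ha⟩)

lemma act_mem_mul {s t : G} {a : A} (ha : a ∈ α.D s⁻¹) (ha' : a ∈ α.D t) :
    α.act s a ∈ α.D (s * t) := by
  have h1 : α.act s a ∈ α.D (s⁻¹)⁻¹ := by rw [inv_inv]; exact α.act_mem ha
  have h2 : α.act s⁻¹ (α.act s a) ∈ α.D (t⁻¹)⁻¹ := by rw [inv_inv, α.act_inv_act ha]; exact ha'
  have := (α.act_act h1 h2).1
  simpa using this

lemma act_mul_act {s t : G} {a : A} (ha : a ∈ α.D t⁻¹) (ha' : a ∈ α.D (s * t)⁻¹) :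
    α.act (s * t) a = α.act s (α.act t a) := by
  refine (α.act_act ha ?_).2
  have := α.act_mem_mul ha ha'
  simpa using this

/-- Every element of an ideal `D s` is a sum of products of two of its elements. -/
lemma mul_induction {s : G} {P : A → Prop} (h0 : P 0)
    (hadd : ∀ x y, x ∈ α.D s → y ∈ α.D s → P x → P y → P (x + y))
    (hsmul : ∀ (c : ℂ) x, x ∈ α.D s → P x → P (c • x))
    (hmul : ∀ x y, x ∈ α.D s → y ∈ α.D s → P (x * y)) {a : A} (ha : a ∈ α.D s) : P a := by
  let _ : PartialOrder (α.D s) := CStarAlgebra.spectralOrder _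
  have _ : StarOrderedRing (α.D s) := CStarAlgebra.spectralOrderedRing _
  have key : ∀ b : α.D s, P b := by
    intro b
    have hb : b ∈ Submodule.span ℂ {a : α.D s | 0 ≤ a} := by
      rw [CStarAlgebra.span_nonneg]; trivial
    induction hb using Submodule.span_induction with
    | mem x hx =>
      have := CFC.sqrt_mul_sqrt_self x hx
      rw [← this]
      exact hmul _ _ (CFC.sqrt x).2 (CFC.sqrt x).2
    | zero => exact h0
    | add x y _ _ hx hy => exact hadd _ _ x.2 y.2 hx hy
    | smul c x _ hx => exact hsmul c _ x.2 hx
  exact key ⟨a, ha⟩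

lemma act_mul_assoc {s : G} (x c : A) {b : A} (hb : b ∈ α.D s) :
    α.act s (α.act s⁻¹ (x * b) * c) = x * α.act s (α.act s⁻¹ b * c) := by
  have m1 : ∀ {y}, y ∈ α.D s → y ∈ α.D (s⁻¹)⁻¹ := fun h => by rwa [inv_inv]
  have m2 : ∀ {y}, y ∈ α.D s → α.act s⁻¹ y * c ∈ α.D s⁻¹ :=
    fun h => α.mul_mem_right _ c (α.act_inv_mem h)
  have m3 : ∀ {y}, y ∈ α.D s → x * y ∈ α.D s := fun h => α.mul_mem_left _ x h
  refine α.mul_induction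
    (P := fun b => α.act s (α.act s⁻¹ (x * b) * c) = x * α.act s (α.act s⁻¹ b * c))
    ?_ ?_ ?_ ?_ hb
  · have z : ∀ r : G, α.act r 0 = 0 := fun r => by
      simpa using α.act_smul (s := r) 0 (zero_mem (α.D r⁻¹))
    simp [z]
  · intro y z hy hz ihy ihz
    rw [mul_add, α.act_add (m1 (m3 hy)) (m1 (m3 hz)), add_mul, α.act_add (m2 (m3 hy)) (m2 (m3 hz)),
      ihy, ihz, α.act_add (m1 hy) (m1 hz), add_mul, α.act_add (m2 hy) (m2 hz), mul_add]
  · intro r y hy ih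
    rw [mul_smul_comm, α.act_smul _ (m1 (m3 hy)), smul_mul_assoc, α.act_smul _ (m2 (m3 hy)), ih,
      α.act_smul _ (m1 hy), smul_mul_assoc, α.act_smul _ (m2 hy), mul_smul_comm]
  · intro y z hy hz
    rw [← mul_assoc, α.act_mul (m1 (m3 hy)) (m1 hz), mul_assoc,
      α.act_mul (α.act_inv_mem (m3 hy)) (m2 hz), α.act_act_inv (m3 hy),
      α.act_mul (m1 hy) (m1 hz), mul_assoc (α.act s⁻¹ y),
      α.act_mul (α.act_inv_mem hy) (m2 hz), α.act_act_inv hy, mul_assoc]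

lemma act_mul_inv_act {s t : G} {y : A} (h1 : y ∈ α.D s⁻¹) (h2 : y ∈ α.D t) :
    α.act (s * t)⁻¹ (α.act s y) = α.act t⁻¹ y := by
  have h3 : α.act s y ∈ α.D (s⁻¹)⁻¹ := by rw [inv_inv]; exact α.act_mem h1
  have h4 : α.act s⁻¹ (α.act s y) ∈ α.D (t⁻¹)⁻¹ := by
    rw [α.act_inv_act h1, inv_inv]; exact h2
  rw [mul_inv_rev, (α.act_act h3 h4).2, α.act_inv_act h1]

/-- The product in `D (s * t)` of `a ∈ D s` and `b ∈ D t`, namely `α_s (α_s⁻¹ (a) b)`. -/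
def mulD {s t : G} (a : α.D s) (b : α.D t) : α.D (s * t) :=
  ⟨(α.α s ⟨(α.α s).symm a * b, α.mul_mem_right _ _ ((α.α s).symm a).2⟩ : A), by
    rw [← act_coe]
    exact α.act_mem_mul (α.mul_mem_right _ _ ((α.α s).symm a).2) (α.mul_mem_left _ _ b.2)⟩

/-- The adjoint in `D s⁻¹` of `a ∈ D s`, namely `α_s⁻¹ (a*)`. -/
def starD {s : G} (a : α.D s) : α.D s⁻¹ := (α.α s).symm (star a)

lemma coe_mulD {s t : G} (a : α.D s) (b : α.D t) :
    (α.mulD a b : A) = α.act s (α.act s⁻¹ a * b) := by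
  rw [← coe_symm]
  exact (α.act_coe ⟨_, α.mul_mem_right _ _ ((α.α s).symm a).2⟩).symm

lemma coe_starD {s : G} (a : α.D s) : (α.starD a : A) = α.act s⁻¹ (star a) := α.coe_symm _

lemma mulD_mem {s t : G} (a : α.D s) (b : α.D t) : α.act s⁻¹ a * b ∈ α.D s⁻¹ :=
  α.mul_mem_right _ _ (α.act_inv_mem a.2)

lemma mulD_assoc {r s t : G} (a : α.D r) (b : α.D s) (c : α.D t) :
    (α.mulD (α.mulD a b) c : A) = α.mulD a (α.mulD b c) := by
  simp only [coe_mulD]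
  have hx : α.act r⁻¹ a ∈ α.D r⁻¹ := α.act_inv_mem a.2
  have h1 : α.act r⁻¹ a * b ∈ α.D r⁻¹ := α.mulD_mem a b
  have h2 : α.act r⁻¹ a * b ∈ α.D s := α.mul_mem_left _ _ b.2
  rw [α.act_mul_inv_act h1 h2, ← α.act_mul_assoc _ _ b.2]
  have h5 : α.act s⁻¹ (α.act r⁻¹ a * b) ∈ α.D s⁻¹ := α.act_inv_mem h2
  have h6 : α.act s⁻¹ (α.act r⁻¹ a * b) ∈ α.D (s⁻¹ * r⁻¹) :=
    α.act_mem_mul (by rwa [inv_inv]) h1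
  exact α.act_mul_act (α.mul_mem_right _ _ h5) (α.mul_mem_right _ _ (by rwa [mul_inv_rev]))

lemma starD_starD {s : G} (a : α.D s) : (α.starD (α.starD a) : A) = a := by
  rw [coe_starD, coe_starD, inv_inv, α.act_star (α.act_inv_mem (star_mem a.2)),
    α.act_act_inv (star_mem a.2), star_star]

lemma starD_mulD {s t : G} (a : α.D s) (b : α.D t) :
    (α.starD (α.mulD a b) : A) = α.mulD (α.starD b) (α.starD a) := by
  have h1 : α.act s⁻¹ a * b ∈ α.D s⁻¹ := α.mulD_mem a b
  have h2 : α.act s⁻¹ a * b ∈ α.D t := α.mul_mem_left _ _ b.2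
  simp only [coe_mulD, coe_starD]
  rw [← α.act_star h1, α.act_mul_inv_act (star_mem h1) (star_mem h2), inv_inv,
    α.act_act_inv (star_mem b.2), star_mul, α.act_star (a := (a : A)) (by rw [inv_inv]; exact a.2)]

/-- The vector space `L_c` of finitely supported functions `f` on `G` with `f s ∈ D s`. -/
def Lc : Type _ := DirectSum G fun s => α.D s

namespace Lc

instance : AddCommGroup α.Lc := inferInstanceAs (AddCommGroup (DirectSum G fun s => α.D s))
instance : Module ℂ α.Lc := inferInstanceAs (Module ℂ (DirectSum G fun s => α.D s))

open Classical in
/-- `F s a` is the function with value `a ∈ D s` at `s` and `0` elsewhere. -/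
def F (s : G) : α.D s →ₗ[ℂ] α.Lc := DirectSum.lof ℂ G (fun s => α.D s) s

open Classical in
/-- The additive map on `L_c` with prescribed values on the functions `F s a`. -/
def lift {M : Type*} [AddCommMonoid M] (f : ∀ s, α.D s →+ M) : α.Lc →+ M :=
  DirectSum.toAddMonoid f

lemma lift_F {M : Type*} [AddCommMonoid M] (f : ∀ s, α.D s →+ M) (s : G) (a : α.D s) :
    lift α f (F α s a) = f s a := by
  classical
  exact DirectSum.toAddMonoid_of f s a

lemma F_congr {s t : G} (h : s = t) {a : α.D s} {b : α.D t} (hab : (a : A) = b) :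
    F α s a = F α t b := by
  subst h
  rw [Subtype.ext hab]

/-- `mulD` as a biadditive map. -/
def mulDHom (s t : G) : α.D s →+ α.D t →+ α.D (s * t) :=
  AddMonoidHom.mk' (fun a => AddMonoidHom.mk' (fun b => α.mulD a b) fun b b' => by
      apply Subtype.ext
      simp only [AddMemClass.coe_add, coe_mulD]
      rw [mul_add, α.act_add (α.mulD_mem a b) (α.mulD_mem a b')]) fun a a' => by
    ext b
    simp only [AddMonoidHom.mk'_apply, AddMonoidHom.add_apply, AddMemClass.coe_add, coe_mulD]
    rw [α.act_add (by rw [inv_inv]; exact a.2) (by rw [inv_inv]; exact a'.2), add_mul,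
      α.act_add (α.mulD_mem a b) (α.mulD_mem a' b)]

/-- `starD` as an additive map. -/
def starDHom (s : G) : α.D s →+ α.D s⁻¹ :=
  AddMonoidHom.mk' (fun a => α.starD a) fun a b => by
    simp [starD]

/-- The biadditive extension of `F(a,s) F(b,t) = F(α_s(α_s⁻¹(a) b), s t)`. -/
def mulHom : α.Lc →+ α.Lc →+ α.Lc :=
  lift α fun s => AddMonoidHom.flip <| lift α fun t =>
    AddMonoidHom.flip <| (mulDHom α s t).compr₂ (F α (s * t)).toAddMonoidHom

/-- The additive extension of `F(a,s)* = F(α_s⁻¹(a*), s⁻¹)`. -/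
def starHom : α.Lc →+ α.Lc :=
  lift α fun s => (F α s⁻¹).toAddMonoidHom.comp (starDHom α s)

instance : Mul α.Lc := ⟨fun x y => mulHom α x y⟩

instance : Star α.Lc := ⟨starHom α⟩

lemma F_mul_F {s t : G} (a : α.D s) (b : α.D t) :
    F α s a * F α t b = F α (s * t) (α.mulD a b) := by
  show mulHom α (F α s a) (F α t b) = _
  rw [mulHom, lift_F, AddMonoidHom.flip_apply, lift_F]
  rfl

lemma star_F {s : G} (a : α.D s) : star (F α s a) = F α s⁻¹ (α.starD a) := by
  show starHom α (F α s a) = _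
  rw [starHom, lift_F]
  rfl

@[elab_as_elim]
lemma ind {P : α.Lc → Prop} (x : α.Lc) (h0 : P 0) (hF : ∀ s a, P (F α s a))
    (hadd : ∀ x y, P x → P y → P (x + y)) : P x := by
  classical
  exact DirectSum.induction_on x h0 hF hadd

lemma add_mul' (x y z : α.Lc) : (x + y) * z = x * z + y * z := by
  show mulHom α (x + y) z = _
  rw [map_add]; rfl

lemma mul_add' (x y z : α.Lc) : x * (y + z) = x * y + x * z :=
  map_add (mulHom α x) y z

lemma zero_mul' (x : α.Lc) : 0 * x = 0 := by
  show mulHom α 0 x = _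
  rw [map_zero]; rfl

lemma mul_zero' (x : α.Lc) : x * 0 = 0 := map_zero (mulHom α x)

instance : NonUnitalRing α.Lc where
  left_distrib := mul_add' α
  right_distrib := add_mul' α
  zero_mul := zero_mul' α
  mul_zero := mul_zero' α
  mul_assoc x y z := by
    induction x using ind with
    | h0 => simp only [zero_mul']
    | hadd x x' hx hx' => simp only [add_mul', hx, hx']
    | hF r a =>
    induction y using ind with
    | h0 => simp only [zero_mul', mul_zero']
    | hadd x x' hx hx' => simp only [add_mul', mul_add', hx, hx']
    | hF s b =>
    induction z using ind with
    | h0 => simp only [mul_zero']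
    | hadd x x' hx hx' => simp only [mul_add', hx, hx']
    | hF t c =>
      rw [F_mul_F, F_mul_F, F_mul_F, F_mul_F]
      exact F_congr α (mul_assoc r s t) (α.mulD_assoc a b c)

instance : StarRing α.Lc where
  star_add x y := map_add (starHom α) x y
  star_involutive x := by
    have h0 : star (0 : α.Lc) = 0 := map_zero (starHom α)
    have ha : ∀ x y : α.Lc, star (x + y) = star x + star y := map_add (starHom α)
    induction x using ind with
    | h0 => rw [h0, h0]
    | hadd x y hx hy => rw [ha, ha, hx, hy]
    | hF s a =>
      rw [star_F, star_F]
      exact F_congr α (inv_inv s) (α.starD_starD a)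
  star_mul x y := by
    have h0 : star (0 : α.Lc) = 0 := map_zero (starHom α)
    have ha : ∀ x y : α.Lc, star (x + y) = star x + star y := map_add (starHom α)
    induction x using ind with
    | h0 => rw [h0, zero_mul, mul_zero, h0]
    | hadd x x' hx hx' => rw [ha, add_mul, mul_add, ha, hx, hx']
    | hF s a =>
    induction y using ind with
    | h0 => rw [h0, zero_mul, mul_zero, h0]
    | hadd x x' hx hx' => rw [ha, mul_add, add_mul, ha, hx, hx']
    | hF t b =>
      rw [F_mul_F, star_F, star_F, star_F, F_mul_F]
      exact F_congr α (mul_inv_rev s t) (α.starD_mulD a b)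

instance : IsScalarTower ℂ α.Lc α.Lc where
  smul_assoc c x y := by
    simp only [smul_eq_mul]
    induction x using ind with
    | h0 => simp
    | hadd x x' hx hx' => rw [smul_add, add_mul, add_mul, smul_add, hx, hx']
    | hF s a =>
    induction y using ind with
    | h0 => simp
    | hadd x x' hx hx' => rw [mul_add, mul_add, smul_add, hx, hx']
    | hF t b =>
      rw [← map_smul, F_mul_F, F_mul_F, ← map_smul]
      refine congrArg _ (Subtype.ext ?_)
      simp only [coe_mulD, SetLike.val_smul]
      rw [α.act_smul c (by rw [inv_inv]; exact a.2), smul_mul_assoc,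
        α.act_smul c (α.mulD_mem a b)]

instance : SMulCommClass ℂ α.Lc α.Lc where
  smul_comm c x y := by
    simp only [smul_eq_mul]
    induction x using ind with
    | h0 => simp
    | hadd x x' hx hx' => rw [add_mul, add_mul, smul_add, hx, hx']
    | hF s a =>
    induction y using ind with
    | h0 => simp
    | hadd x x' hx hx' => rw [smul_add, mul_add, mul_add, smul_add, hx, hx']
    | hF t b =>
      rw [← map_smul, F_mul_F, F_mul_F, ← map_smul]
      refine congrArg _ (Subtype.ext ?_)
      simp only [coe_mulD, SetLike.val_smul]
      rw [mul_smul_comm, α.act_smul c (α.mulD_mem a b)]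

instance : StarModule ℂ α.Lc where
  star_smul c x := by
    induction x using ind with
    | h0 => simp
    | hadd x y hx hy => rw [smul_add, star_add, star_add, smul_add, hx, hy]
    | hF s a =>
      rw [← map_smul, star_F, star_F, ← map_smul]
      refine congrArg _ (Subtype.ext ?_)
      simp only [coe_starD, SetLike.val_smul, star_smul]
      rw [α.act_smul _ (by rw [inv_inv]; exact star_mem a.2)]

end Lc

end PartialAction

namespace PartialAction

open Bidual

variable {G A : Type*} [Group G] [NonUnitalCStarAlgebra A] (α : PartialAction G A)

/-- The inclusion of the ideal `D s` in `A`. -/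
def incl (s : G) : α.D s →L[ℂ] A where
  toFun a := a
  map_add' _ _ := rfl
  map_smul' _ _ := rfl
  cont := continuous_subtype_val

namespace Lc

/-- The embedding `a ↦ F(a, e)` of `A` in `L_c`. -/
def ofA : A →ₗ[ℂ] α.Lc where
  toFun a := F α 1 ⟨a, α.mem_one a⟩
  map_add' a b := (map_add (F α 1) ⟨a, α.mem_one a⟩ ⟨b, α.mem_one b⟩ :)
  map_smul' c a := (map_smul (F α 1) c ⟨a, α.mem_one a⟩ :)

lemma ofA_apply (a : A) : ofA α a = F α 1 ⟨a, α.mem_one a⟩ := rfl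

lemma ofA_mul_F (a : A) {s : G} (b : α.D s) :
    ofA α a * F α s b = F α s ⟨a * b, α.mul_mem_left _ _ b.2⟩ := by
  rw [ofA_apply, F_mul_F]
  refine F_congr α (one_mul s) ?_
  rw [coe_mulD, inv_one, act_one, act_one]

lemma F_mul_ofA {s : G} (a : α.D s) (b : A) :
    F α s a * ofA α b
      = F α s (α.α s ⟨(α.α s).symm a * b, α.mul_mem_right _ _ ((α.α s).symm a).2⟩) := by
  rw [ofA_apply, F_mul_F]
  exact F_congr α (mul_one s) rfl

lemma ofA_mul (a b : A) : ofA α (a * b) = ofA α a * ofA α b := by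
  rw [ofA_apply α b, ofA_mul_F]; rfl

lemma ofA_star (a : A) : ofA α (star a) = star (ofA α a) := by
  rw [ofA_apply, ofA_apply, star_F]
  refine F_congr α inv_one.symm ?_
  rw [coe_starD, inv_one, act_one]

lemma star_F_mul_F {s : G} (a : α.D s) :
    star (F α s a) * F α s a = ofA α ((α.α s).symm (star a * a)) := by
  rw [star_F, F_mul_F, ofA_apply]
  refine F_congr α (inv_mul_cancel s) ?_
  rw [coe_mulD, coe_symm, coe_starD, inv_inv, α.act_act_inv (star_mem a.2)]
  rfl

lemma seminorm_F_le (p : CStarSeminorm α.Lc) {s : G} (a : α.D s) :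
    p.toSeminorm (F α s a) ≤ ‖a‖ := by
  let q : CStarSeminorm A :=
    { toSeminorm := p.toSeminorm.comp (ofA α)
      mul_le := fun x y => by
        simp only [Seminorm.comp_apply, ofA_mul]; exact p.mul_le _ _
      star_mul_self := fun x => by
        simp only [Seminorm.comp_apply, ofA_mul, ofA_star]; exact p.star_mul_self _ }
  have h1 : p.toSeminorm (F α s a) ^ 2 ≤ ‖a‖ ^ 2 := by
    rw [← p.star_mul_self, star_F_mul_F]
    calc _ ≤ ‖((α.α s).symm (star a * a) : A)‖ := q.le_norm _
      _ = ‖(α.α s).symm (star a * a)‖ := rfl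
      _ ≤ ‖star a * a‖ := NonUnitalStarAlgHom.norm_apply_le (α.α s).symm _
      _ = ‖a‖ ^ 2 := by rw [CStarRing.norm_star_mul_self, sq]
  exact le_of_sq_le_sq h1 (norm_nonneg _)

/-- The greatest C⋆-seminorm on `L_c` is finite. -/
lemma bddAbove (x : α.Lc) :
    BddAbove (Set.range fun p : CStarSeminorm α.Lc => p.toSeminorm x) := by
  induction x using ind with
  | h0 => exact ⟨0, by rintro _ ⟨p, rfl⟩; simp⟩
  | hF s a => exact ⟨‖a‖, by rintro _ ⟨p, rfl⟩; exact seminorm_F_le α p a⟩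
  | hadd x y hx hy =>
    obtain ⟨c, hc⟩ := hx
    obtain ⟨d, hd⟩ := hy
    refine ⟨c + d, ?_⟩
    rintro _ ⟨p, rfl⟩
    exact (map_add_le_add p.toSeminorm x y).trans (add_le_add (hc ⟨p, rfl⟩) (hd ⟨p, rfl⟩))

end Lc

/-- The crossed product `A ⋊_α G`: the completion of the ⋆-algebra `L_c` in its greatest
C⋆-seminorm. -/
abbrev CrossedProduct : Type _ := (CStarSeminorm.greatest (Lc.bddAbove α)).Completion

/-- The element `F(a, s)` of the crossed product, for `a ∈ D s`. -/
def F (s : G) : α.D s →L[ℂ] α.CrossedProduct :=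
  LinearMap.mkContinuous ((CStarSeminorm.Completion.of _).comp (Lc.F α s)) 1 fun a => by
    rw [_root_.one_mul]
    exact (CStarSeminorm.Completion.norm_of _ _).trans_le (Lc.seminorm_F_le α _ a)

/-- The canonical map `a ↦ F(a, e)` of `A` into the crossed product. -/
def ofA : A →L[ℂ] α.CrossedProduct :=
  LinearMap.mkContinuous ((CStarSeminorm.Completion.of _).comp (Lc.ofA α)) 1 fun a => by
    rw [_root_.one_mul]
    exact (CStarSeminorm.Completion.norm_of _ _).trans_le (Lc.seminorm_F_le α _ _)

lemma F_apply (s : G) (a : α.D s) :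
    α.F s a = CStarSeminorm.Completion.of _ (Lc.F α s a) := rfl

lemma ofA_apply (a : A) : α.ofA a = CStarSeminorm.Completion.of _ (Lc.ofA α a) := rfl

lemma ofA_mul_F (a : A) {s : G} (b : α.D s) :
    α.ofA a * α.F s b = α.F s ⟨a * b, α.mul_mem_left _ _ b.2⟩ := by
  rw [F_apply, F_apply, ofA_apply, ← CStarSeminorm.Completion.of_mul, Lc.ofA_mul_F]

lemma F_mul_ofA {s : G} (a : α.D s) (b : A) :
    α.F s a * α.ofA b
      = α.F s (α.α s ⟨(α.α s).symm a * b, α.mul_mem_right _ _ ((α.α s).symm a).2⟩) := by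
  rw [F_apply, F_apply, ofA_apply, ← CStarSeminorm.Completion.of_mul, Lc.F_mul_ofA]

/-- The projection `p_s ∈ A**`: the identity of `D_s**`, regarded as an element of `A**`. -/
def p (s : G) : Bidual A := Bidual.map (α.incl s) (Bidual.one (α.D s))

/-- The projection `p_s`, regarded as an element of `(A ⋊_α G)**`. -/
def pCross (s : G) : Bidual α.CrossedProduct := Bidual.map α.ofA (α.p s)

/-- The defining property of the element `m_s` of `p_s (A ⋊_α G)** p_{s⁻¹}`, which is the multiplier
of the `D_s - D_{s⁻¹}` imprimitivity bimodule `X_s = {F(a, s) | a ∈ D_s}` given by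
`a · m_s = F(a, s)` for `a ∈ D_s` and `m_s · b = F(α_s(b), s)` for `b ∈ D_{s⁻¹}`. -/
structure IsM (s : G) (m : Bidual α.CrossedProduct) : Prop where
  left : Bidual.mul (α.pCross s) m = m
  right : Bidual.mul m (α.pCross s⁻¹) = m
  mul_left : ∀ a : α.D s, Bidual.mul (ofElem (α.ofA a)) m = ofElem (α.F s a)
  mul_right : ∀ b : α.D s⁻¹, Bidual.mul m (ofElem (α.ofA b)) = ofElem (α.F s (α.α s b))

lemma one_actRight {E : Type*} [NonUnitalCStarAlgebra E] (φ : StrongDual ℂ E) (a : E) :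
    Bidual.one E (actRight φ a) = φ a := by
  have := congrArg (fun x : Bidual E => x φ) (Bidual.mul_one (ofElem a))
  exact this

lemma isM_unique {s : G} {m : Bidual α.CrossedProduct} (h : α.IsM s m) :
    m = Bidual.map (α.F s) (Bidual.one (α.D s)) := by
  ext φ
  conv_lhs => rw [← h.left]
  show Bidual.one (α.D s) (((actLeft m φ).comp α.ofA).comp (α.incl s)) = _
  rw [Bidual.map_apply]
  congr 1
  ext a
  exact congrArg (fun x : Bidual α.CrossedProduct => x φ) (h.mul_left a)

lemma isM_map (s : G) : α.IsM s (Bidual.map (α.F s) (Bidual.one (α.D s))) := by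
  have hl : ∀ a : α.D s, Bidual.mul (ofElem (α.ofA a)) (Bidual.map (α.F s) (Bidual.one (α.D s)))
      = ofElem (α.F s a) := by
    intro a
    ext φ
    show Bidual.one (α.D s) ((actRight φ (α.ofA a)).comp (α.F s)) = φ (α.F s a)
    rw [show (actRight φ (α.ofA a)).comp (α.F s) = actRight (φ.comp (α.F s)) a from ?_,
      one_actRight]
    · rfl
    · ext b
      exact congrArg φ (α.ofA_mul_F a b)
  refine ⟨?_, ?_, hl, ?_⟩
  · ext φ
    show Bidual.one (α.D s) (((actLeft _ φ).comp α.ofA).comp (α.incl s)) = _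
    rw [Bidual.map_apply]
    congr 1
    ext a
    exact congrArg (fun x : Bidual α.CrossedProduct => x φ) (hl a)
  · ext φ
    rw [mul_apply, Bidual.map_apply, Bidual.map_apply]
    congr 1
    ext a
    show Bidual.one (α.D s⁻¹) (((actRight φ (α.F s a)).comp α.ofA).comp (α.incl s⁻¹)) = φ (α.F s a)
    let T : α.D s⁻¹ →L[ℂ] α.D s :=
      LinearMap.mkContinuous (LinearMapClass.linearMap (α.α s)) 1 fun b => by
        rw [_root_.one_mul]; exact NonUnitalStarAlgHom.norm_apply_le (α.α s) b
    have e : ((actRight φ (α.F s a)).comp α.ofA).comp (α.incl s⁻¹)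
        = actRight ((φ.comp (α.F s)).comp T) ((α.α s).symm a) := by
      ext b
      exact congrArg φ (α.F_mul_ofA a b)
    rw [e, one_actRight]
    exact congrArg (fun y => φ (α.F s y)) ((α.α s).apply_symm_apply a)
  · intro b
    ext φ
    show Bidual.one (α.D s) ((actLeft (ofElem (α.ofA b)) φ).comp (α.F s)) = φ (α.F s (α.α s b))
    have e : (actLeft (ofElem (α.ofA (b : A))) φ).comp (α.F s)
        = actLeft (ofElem (α.α s b)) (φ.comp (α.F s)) := by
      ext a
      show φ (α.F s a * α.ofA b) = φ (α.F s (a * α.α s b))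
      rw [F_mul_ofA]
      refine congrArg (fun y => φ (α.F s y)) ?_
      have : (⟨(α.α s).symm a * b, α.mul_mem_right _ _ ((α.α s).symm a).2⟩ : α.D s⁻¹)
        = (α.α s).symm a * b := rfl
      rw [this, map_mul, StarAlgEquiv.apply_symm_apply]
    rw [e]
    exact congrArg (fun x : Bidual (α.D s) => x (φ.comp (α.F s)))
      (Bidual.one_mul (ofElem (α.α s b)))

theorem existsUnique_m (s : G) : ∃! m, α.IsM s m :=
  ⟨_, α.isM_map s, fun _ h => α.isM_unique h⟩

/-- The element `m_s` of `(A ⋊_α G)**`. -/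
def m (s : G) : Bidual α.CrossedProduct := (α.existsUnique_m s).choose

lemma isM_m (s : G) : α.IsM s (α.m s) := (α.existsUnique_m s).choose_spec.1

end PartialAction

/-- The multiplier algebra `M(E)` of a C⋆-algebra `E`, realized in the double dual:
`M(E) = {x ∈ E** | x E ∪ E x ⊆ E}`. -/
def multiplierAlgebra (E : Type*) [NonUnitalCStarAlgebra E] : Set (Bidual E) :=
  {x | ∀ a : E, Bidual.mul x (Bidual.ofElem a) ∈ Set.range (Bidual.ofElem (E := E)) ∧
    Bidual.mul (Bidual.ofElem a) x ∈ Set.range (Bidual.ofElem (E := E))}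

end

/-!
The projection `p_s` is central and satisfies `A p_s ⊆ D_s**`, while `A ∩ D_s** = D_s` by
Hahn–Banach. Hence `p_s` multiplies `A` into `A` exactly when it multiplies `A` into `D_s`, and the
equivalence of (i), (ii) and (iii) follows.

For (iv) ⟹ (i), make `L_c` a left Hilbert `A`-module with inner product `∑ f(s) g(s)⋆`, the value
at `e` of `f g⋆`. Right multiplication represents `L_c` on it and gives a C⋆-seminorm which
dominates every `f ↦ ‖f(s)‖`, so the evaluation `f ↦ f(s)` extends to the crossed product. The
double transpose of the extension sends `a m_s` to `a p_s`; if `a m_s` lies in the crossed product,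
then `a p_s` lies in `A`.

For the last assertion, an approximate unit of `A` is one for the crossed product, so it suffices
that `a m_s` and `m_s a` lie in the crossed product for `a ∈ A`; and `a m_s = (a p_s) m_s` with
`a p_s ∈ D_s`, `m_s a = m_s (p_{s⁻¹} a)` with `p_{s⁻¹} a ∈ D_{s⁻¹}`.
-/

noncomputable section

namespace Bidual

open Filter Topology

section NormedSpace

variable {E F H : Type*} [NormedAddCommGroup E] [NormedSpace ℂ E]
  [NormedAddCommGroup F] [NormedSpace ℂ F] [NormedAddCommGroup H] [NormedSpace ℂ H]

lemma map_map (T : F →L[ℂ] H) (S : E →L[ℂ] F) (x : Bidual E) :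
    map T (map S x) = map (T ∘L S) x := rfl

lemma isometry_ofElem : Isometry (ofElem : E → Bidual E) :=
  (NormedSpace.inclusionInDoubleDualLi ℂ).isometry

lemma isClosed_range_ofElem [CompleteSpace E] : IsClosed (Set.range (ofElem : E → Bidual E)) :=
  isometry_ofElem.isClosedEmbedding.isClosed_range

lemma mem_closure_range_of_ofElem_eq_map {T : E →L[ℂ] F} {y : Bidual E} {c : F}
    (h : ofElem c = map T y) : c ∈ closure (Set.range T) := by
  by_contra hc
  let K := T.range.topologicalClosure
  have : IsClosed (K : Set F) := T.range.isClosed_topologicalClosure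
  obtain ⟨ψ, hψ⟩ := SeparatingDual.exists_ne_zero (R := ℂ) (x := K.mkQL c)
    fun h0 => hc ((Submodule.Quotient.mk_eq_zero K).1 h0)
  have hψT : (ψ ∘L K.mkQL) ∘L T = 0 := by
    ext b
    have hb : K.mkQ (T b) = 0 :=
      (Submodule.Quotient.mk_eq_zero K).2 (T.range.le_topologicalClosure ⟨b, rfl⟩)
    exact (congrArg ψ hb).trans (map_zero ψ)
  refine hψ ?_
  calc ψ (K.mkQL c) = y ((ψ ∘L K.mkQL) ∘L T) := congrArg (fun x : Bidual F => x (ψ ∘L K.mkQL)) h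
    _ = 0 := by rw [hψT, map_zero]

end NormedSpace

section Algebra

variable {E F H : Type*} [NormedAddCommGroup H] [NormedSpace ℂ H]
  [NonUnitalNormedRing E] [NormedSpace ℂ E] [IsScalarTower ℂ E E] [SMulCommClass ℂ E E]
  [NonUnitalNormedRing F] [NormedSpace ℂ F] [IsScalarTower ℂ F F] [SMulCommClass ℂ F F]

lemma ofElem_mul (a b : E) : ofElem (a * b) = mul (ofElem a) (ofElem b) := rfl

lemma ofElem_mul_map (a : E) (S : H →L[ℂ] E) (y : Bidual H) :
    mul (ofElem a) (map S y) = map (ContinuousLinearMap.mul ℂ E a ∘L S) y := rfl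

lemma mul_assoc (x y z : Bidual E) : mul (mul x y) z = mul x (mul y z) := by
  have h (φ : StrongDual ℂ E) : actLeft y (actLeft z φ) = actLeft (mul y z) φ := by
    ext a
    have ha : actRight (actLeft z φ) a = actLeft z (actRight φ a) := by
      ext b
      have hb : actRight φ (a * b) = actRight (actRight φ a) b := by
        ext c
        simp only [actRight_apply, _root_.mul_assoc]
      simp only [actRight_apply, actLeft_apply, hb]
    simp only [actLeft_apply, mul_apply, ha]
  ext φ
  simp only [mul_apply, h]

lemma map_mul {T : E →L[ℂ] F} (hT : ∀ a b, T (a * b) = T a * T b) (x y : Bidual E) :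
    map T (mul x y) = mul (map T x) (map T y) := by
  have h (φ : StrongDual ℂ F) : actLeft y (φ ∘L T) = actLeft (map T y) φ ∘L T := by
    ext a
    have ha : actRight (φ ∘L T) a = actRight φ (T a) ∘L T := by
      ext b
      simp only [actRight_apply, ContinuousLinearMap.comp_apply, hT]
    simp only [actLeft_apply, map_apply, ContinuousLinearMap.comp_apply, ha]
  ext φ
  simp only [map_apply, mul_apply, h]

lemma continuous_mul_left (x : Bidual E) : Continuous fun y => mul x y := by
  unfold mul actLeft
  fun_prop

lemma continuous_mul_right (y : Bidual E) : Continuous fun x => mul x y := by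
  unfold mul
  fun_prop

end Algebra

section Multipliers

variable {E : Type*} [NonUnitalCStarAlgebra E]

variable (E) in
lemma one_mem_multiplierAlgebra : one E ∈ multiplierAlgebra E := by
  intro a
  rw [one_mul, mul_one]
  exact ⟨⟨a, rfl⟩, ⟨a, rfl⟩⟩

-- `x (a b) = (x a) b` lies in `E` as soon as `x a` does, and `a b → b` along `l`.
lemma mem_multiplierAlgebra_of_isApproximateUnit {x : Bidual E} {l : Filter E}
    (hl : l.IsApproximateUnit)
    (hx : ∀ᶠ a in l, mul x (ofElem a) ∈ Set.range (ofElem (E := E)) ∧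
      mul (ofElem a) x ∈ Set.range (ofElem (E := E))) :
    x ∈ multiplierAlgebra E := by
  have := hl.neBot
  intro b
  constructor
  · refine isClosed_range_ofElem.mem_of_tendsto
      ((((continuous_mul_left x).comp isometry_ofElem.continuous).tendsto b).comp
        (hl.tendsto_mul_right b)) (hx.mono fun a ha => ?_)
    obtain ⟨c, hc⟩ := ha.1
    exact ⟨c * b, by simp only [Function.comp_apply, ofElem_mul, hc, mul_assoc]⟩
  · refine isClosed_range_ofElem.mem_of_tendsto
      ((((continuous_mul_right x).comp isometry_ofElem.continuous).tendsto b).comp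
        (hl.tendsto_mul_left b)) (hx.mono fun a ha => ?_)
    obtain ⟨c, hc⟩ := ha.2
    exact ⟨b * c, by simp only [Function.comp_apply, ofElem_mul, hc, mul_assoc]⟩

end Multipliers

section Ideals

variable {A : Type*} [NonUnitalCStarAlgebra A] (J : NonUnitalStarSubalgebra ℂ A)

/-- The inclusion `J → A` of a star subalgebra, as a bounded operator; its double transpose
identifies `J**` with a subspace of `A**`. -/
def inclusion : J →L[ℂ] A where
  toFun a := a
  map_add' _ _ := rfl
  map_smul' _ _ := rfl
  cont := continuous_subtype_val

variable {J} in
lemma mul_mem_right_of_mul_mem_left (hJ : ∀ (a : A) {b : A}, b ∈ J → a * b ∈ J) (a : A) {b : A}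
    (hb : b ∈ J) : b * a ∈ J := by
  simpa using star_mem (hJ (star a) (star_mem hb))

variable [IsClosed (J : Set A)]

/-- The identity of `J** ⊆ A**`, for a closed star subalgebra `J` of `A`. For an ideal `J` this is
the central support projection of `J`. -/
def supportProjection : Bidual A := map (inclusion J) (one J)

variable {J}

lemma map_inclusion_mul (x y : Bidual J) :
    map (inclusion J) (mul x y) = mul (map (inclusion J) x) (map (inclusion J) y) :=
  map_mul (fun _ _ => rfl) x y

lemma supportProjection_mul_map_inclusion (x : Bidual J) :
    mul (supportProjection J) (map (inclusion J) x) = map (inclusion J) x := by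
  rw [supportProjection, ← map_inclusion_mul, one_mul]

lemma map_inclusion_mul_supportProjection (x : Bidual J) :
    mul (map (inclusion J) x) (supportProjection J) = map (inclusion J) x := by
  rw [supportProjection, ← map_inclusion_mul, mul_one]

lemma ofElem_mul_map_inclusion_mem_range (hJ : ∀ (a : A) {b : A}, b ∈ J → a * b ∈ J) (a : A)
    (x : Bidual J) : mul (ofElem a) (map (inclusion J) x) ∈ Set.range (map (inclusion J)) :=
  ⟨map ((ContinuousLinearMap.mul ℂ A a ∘L inclusion J).codRestrict
    J.toNonUnitalSubalgebra.toSubmodule fun b => hJ a b.2) x, rfl⟩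

lemma map_inclusion_mul_ofElem_mem_range (hJ : ∀ (a : A) {b : A}, b ∈ J → a * b ∈ J) (a : A)
    (x : Bidual J) : mul (map (inclusion J) x) (ofElem a) ∈ Set.range (map (inclusion J)) :=
  ⟨map (((ContinuousLinearMap.mul ℂ A).flip a ∘L inclusion J).codRestrict
    J.toNonUnitalSubalgebra.toSubmodule fun b => mul_mem_right_of_mul_mem_left hJ a b.2) x, rfl⟩

lemma ofElem_mul_supportProjection (hJ : ∀ (a : A) {b : A}, b ∈ J → a * b ∈ J) (a : A) :
    mul (ofElem a) (supportProjection J) = mul (supportProjection J) (ofElem a) := by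
  obtain ⟨x, hx⟩ := ofElem_mul_map_inclusion_mem_range hJ a (one J)
  obtain ⟨y, hy⟩ := map_inclusion_mul_ofElem_mem_range hJ a (one J)
  calc mul (ofElem a) (supportProjection J)
      = mul (supportProjection J) (mul (ofElem a) (supportProjection J)) :=
        (hx ▸ supportProjection_mul_map_inclusion x).symm
    _ = mul (mul (supportProjection J) (ofElem a)) (supportProjection J) := (mul_assoc _ _ _).symm
    _ = mul (supportProjection J) (ofElem a) := hy ▸ map_inclusion_mul_supportProjection y

lemma mem_of_ofElem_eq_map_inclusion {c : A} {x : Bidual J}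
    (h : ofElem c = map (inclusion J) x) : c ∈ J := by
  have hc := mem_closure_range_of_ofElem_eq_map h
  rwa [show Set.range (inclusion J) = J from Subtype.range_coe,
    IsClosed.closure_eq (s := (J : Set A)) inferInstance] at hc

lemma exists_mem_ofElem_mul_supportProjection_eq (hJ : ∀ (a : A) {b : A}, b ∈ J → a * b ∈ J)
    (hp : supportProjection J ∈ multiplierAlgebra A) (a : A) :
    ∃ c ∈ J, mul (ofElem a) (supportProjection J) = ofElem c := by
  obtain ⟨c, hc⟩ := (hp a).2
  obtain ⟨x, hx⟩ := ofElem_mul_map_inclusion_mem_range hJ a (one J)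
  exact ⟨c, mem_of_ofElem_eq_map_inclusion (hc.trans hx.symm), hc.symm⟩

lemma supportProjection_mem_multiplierAlgebra_iff (hJ : ∀ (a : A) {b : A}, b ∈ J → a * b ∈ J) :
    supportProjection J ∈ multiplierAlgebra A ↔
      ∀ a : A, mul (ofElem a) (supportProjection J) ∈ Set.range (ofElem (E := A)) :=
  ⟨fun h a => (h a).2, fun h a => ⟨ofElem_mul_supportProjection hJ a ▸ h a, h a⟩⟩

theorem supportProjection_mem_multiplierAlgebra_iff_image_eq_range
    (hJ : ∀ (a : A) {b : A}, b ∈ J → a * b ∈ J) :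
    supportProjection J ∈ multiplierAlgebra A ↔
      ofElem '' (J : Set A) = Set.range fun a : A => mul (ofElem a) (supportProjection J) := by
  constructor
  · intro hp
    refine Set.Subset.antisymm ?_ ?_
    · rintro _ ⟨c, hc, rfl⟩
      exact ⟨c, map_inclusion_mul_supportProjection (ofElem ⟨c, hc⟩)⟩
    · rintro _ ⟨a, rfl⟩
      obtain ⟨c, hc, hac⟩ := exists_mem_ofElem_mul_supportProjection_eq hJ hp a
      exact ⟨c, hc, hac.symm⟩
  · intro h
    rw [supportProjection_mem_multiplierAlgebra_iff hJ, ← Set.range_subset_iff, ← h]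
    exact Set.image_subset_range _ _

lemma map_inclusion_mem_multiplierAlgebra (hJ : ∀ (a : A) {b : A}, b ∈ J → a * b ∈ J)
    (hp : supportProjection J ∈ multiplierAlgebra A) {x : Bidual J}
    (hx : x ∈ multiplierAlgebra J) : map (inclusion J) x ∈ multiplierAlgebra A := by
  intro a
  obtain ⟨c, hc, hac⟩ := exists_mem_ofElem_mul_supportProjection_eq hJ hp a
  obtain ⟨⟨d, hd⟩, ⟨d', hd'⟩⟩ := hx ⟨c, hc⟩
  refine ⟨⟨d, ?_⟩, ⟨d', ?_⟩⟩
  · calc ofElem (d : A) = mul (map (inclusion J) x) (ofElem c) :=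
          (congrArg (map (inclusion J)) hd).trans (map_inclusion_mul _ _)
      _ = mul (map (inclusion J) x) (mul (supportProjection J) (ofElem a)) := by
          rw [← hac, ofElem_mul_supportProjection hJ]
      _ = mul (map (inclusion J) x) (ofElem a) := by
          rw [← mul_assoc, map_inclusion_mul_supportProjection]
  · calc ofElem (d' : A) = mul (ofElem c) (map (inclusion J) x) :=
          (congrArg (map (inclusion J)) hd').trans (map_inclusion_mul _ _)
      _ = mul (mul (ofElem a) (supportProjection J)) (map (inclusion J) x) := by rw [hac]
      _ = mul (ofElem a) (map (inclusion J) x) := by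
          rw [mul_assoc, supportProjection_mul_map_inclusion]

theorem supportProjection_mem_multiplierAlgebra_iff_image_subset
    (hJ : ∀ (a : A) {b : A}, b ∈ J → a * b ∈ J) :
    supportProjection J ∈ multiplierAlgebra A ↔
      map (inclusion J) '' multiplierAlgebra J ⊆ multiplierAlgebra A :=
  ⟨fun hp => Set.image_subset_iff.2 fun _ => map_inclusion_mem_multiplierAlgebra hJ hp,
    fun h => h ⟨one J, one_mem_multiplierAlgebra J, rfl⟩⟩

end Ideals

end Bidual

section HilbertModule

variable {A E : Type*} [NonUnitalCStarAlgebra A] [PartialOrder A] [StarOrderedRing A]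
  [NormedAddCommGroup E] [NormedSpace ℂ E] [SMul A E] [CStarModule A E]

open CStarModule

lemma opNorm_sq_le_of_inner_apply_left {S T : E →L[ℂ] E}
    (h : ∀ x y, inner A (T x) y = inner A x (S y)) : ‖T‖ ^ 2 ≤ ‖S ∘L T‖ := by
  refine (Real.le_sqrt (norm_nonneg _) (norm_nonneg _)).1 ?_
  refine ContinuousLinearMap.opNorm_le_bound _ (Real.sqrt_nonneg _) fun x => ?_
  refine le_of_sq_le_sq ?_ (by positivity)
  calc ‖T x‖ ^ 2 = ‖inner A x (S (T x))‖ := by rw [norm_sq_eq A, h]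
    _ ≤ ‖x‖ * ‖(S ∘L T) x‖ := norm_inner_le E
    _ ≤ ‖x‖ * (‖S ∘L T‖ * ‖x‖) := by gcongr; exact (S ∘L T).le_opNorm x
    _ = (√‖S ∘L T‖ * ‖x‖) ^ 2 := by rw [mul_pow, Real.sq_sqrt (norm_nonneg _)]; ring

lemma opNorm_le_of_inner_apply_left {S T : E →L[ℂ] E}
    (h : ∀ x y, inner A (T x) y = inner A x (S y)) : ‖T‖ ≤ ‖S‖ := by
  have hST := (opNorm_sq_le_of_inner_apply_left h).trans (S.opNorm_comp_le T)
  nlinarith [norm_nonneg S, norm_nonneg T]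

/-- The C⋆-seminorm `f ↦ ‖ρ f‖` given by a right action `ρ` of a ⋆-algebra on a (not necessarily
complete) Hilbert module by operators whose adjoints are the actions of the `star f`. -/
def CStarSeminorm.ofRightAction {L : Type*} [NonUnitalRing L] [Module ℂ L] [StarRing L]
    (ρ : L →ₗ[ℂ] E →L[ℂ] E) (hmul : ∀ f g, ρ (f * g) = ρ g ∘L ρ f)
    (hstar : ∀ f x y, inner A (ρ f x) y = inner A x (ρ (star f) y)) : CStarSeminorm L where
  toSeminorm := (normSeminorm ℂ (E →L[ℂ] E)).comp ρ
  mul_le f g := by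
    change ‖ρ (f * g)‖ ≤ ‖ρ f‖ * ‖ρ g‖
    rw [hmul, mul_comm]
    exact (ρ g).opNorm_comp_le (ρ f)
  star_mul_self f := by
    change ‖ρ (star f * f)‖ = ‖ρ f‖ ^ 2
    have hle : ‖ρ (star f)‖ ≤ ‖ρ f‖ :=
      opNorm_le_of_inner_apply_left fun x y => by rw [hstar, star_star]
    have hge : ‖ρ f‖ ≤ ‖ρ (star f)‖ := opNorm_le_of_inner_apply_left (hstar f)
    rw [hmul]
    refine le_antisymm ?_ ?_
    · exact ((ρ f).opNorm_comp_le _).trans (by rw [sq]; gcongr)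
    · calc ‖ρ f‖ ^ 2 ≤ ‖ρ (star f)‖ ^ 2 := by gcongr
        _ ≤ ‖ρ f ∘L ρ (star f)‖ :=
          opNorm_sq_le_of_inner_apply_left fun x y => by rw [hstar, star_star]

end HilbertModule

-- The functional calculus turns `‖a‖ - c` into a formal square root of `‖a‖² - a a⋆`.
lemma exists_isSelfAdjoint_smul_sub_mul_self {A : Type*} [NonUnitalCStarAlgebra A] (a : A) :
    ∃ c : A, IsSelfAdjoint c ∧ ((2 * ‖a‖ : ℝ) : ℂ) • c - c * c = a * star a := by
  let _ : PartialOrder A := CStarAlgebra.spectralOrder A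
  have _ : StarOrderedRing A := CStarAlgebra.spectralOrderedRing A
  let f : ℝ → ℝ := fun t => ‖a‖ - √(‖a‖ ^ 2 - t)
  have _ : Continuous f := by fun_prop
  have _ : f 0 = 0 := by simp [f]
  refine ⟨cfcₙ f (a * star a), cfcₙ_predicate f _, ?_⟩
  rw [Complex.coe_smul, ← cfcₙ_const_mul _ f (a * star a), ← cfcₙ_mul f f (a * star a),
    ← cfcₙ_sub ..]
  conv_rhs => rw [← cfcₙ_id' ℝ (a * star a)]
  refine cfcₙ_congr fun t ht => ?_
  have hta : t ≤ ‖a‖ ^ 2 := by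
    rw [sq, ← CStarRing.norm_self_mul_star]
    exact (le_abs_self t).trans
      (NonUnitalIsometricContinuousFunctionalCalculus.norm_quasispectrum_le _ ht)
  have hsqrt := Real.mul_self_sqrt (sub_nonneg.2 hta)
  simp only [f]
  linarith

namespace PartialAction

variable {G A : Type*} [Group G] [NonUnitalCStarAlgebra A] (α : PartialAction G A)

namespace Lc

/-- The value `f s ∈ A` of a finitely supported function `f ∈ L_c`. -/
def coeff (s : G) : α.Lc →ₗ[ℂ] A :=
  (α.incl s : α.D s →ₗ[ℂ] A) ∘ₗ DirectSum.component ℂ G (fun s => α.D s) s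

@[simp]
lemma coeff_F_self (s : G) (a : α.D s) : coeff α s (F α s a) = a := by
  classical
  exact congrArg Subtype.val (DirectSum.component.lof_self ℂ (M := fun s => α.D s) s a)

lemma coeff_F_of_ne {s t : G} (h : t ≠ s) (a : α.D t) : coeff α s (F α t a) = 0 := by
  classical
  exact congrArg Subtype.val
    ((DirectSum.component.of ℂ (M := fun s => α.D s) s t a).trans (dif_neg h))

@[simp]
lemma coeff_one_ofA (a : A) : coeff α 1 (ofA α a) = a := coeff_F_self α 1 _

lemma eq_zero_of_coeff_eq_zero {x : α.Lc} (h : ∀ s, coeff α s x = 0) : x = 0 :=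
  DFinsupp.ext fun s => Subtype.ext (h s)

lemma coeff_ofA_mul (s : G) (a : A) (x : α.Lc) : coeff α s (ofA α a * x) = a * coeff α s x := by
  induction x using ind with
  | h0 => simp only [mul_zero, map_zero]
  | hadd x y hx hy => simp only [mul_add, map_add, hx, hy]
  | hF t b =>
    rw [ofA_mul_F]
    rcases eq_or_ne t s with rfl | h
    · simp only [coeff_F_self]
    · simp only [coeff_F_of_ne α h, mul_zero]

lemma F_mul_star_F_self {s : G} (a b : α.D s) :
    F α s a * star (F α s b) = ofA α ((a : A) * star (b : A)) := by
  have hb : star (b : A) ∈ α.D s := star_mem b.2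
  rw [star_F, F_mul_F, ofA_apply]
  refine F_congr α (mul_inv_cancel s) ?_
  rw [coe_mulD, coe_starD, α.act_mul (α.act_inv_mem a.2) (α.act_inv_mem hb), α.act_act_inv a.2,
    α.act_act_inv hb]

lemma coeff_one_star (x : α.Lc) : coeff α 1 (star x) = star (coeff α 1 x) := by
  induction x using ind with
  | h0 => simp only [star_zero, map_zero]
  | hadd x y hx hy => simp only [star_add, map_add, hx, hy]
  | hF t b =>
    rcases eq_or_ne t 1 with rfl | h
    · change coeff α 1 (star (ofA α (b : A))) = star (coeff α 1 (ofA α (b : A)))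
      simp only [← ofA_star, coeff_one_ofA]
    · rw [star_F, coeff_F_of_ne α h, coeff_F_of_ne α (inv_ne_one.2 h), star_zero]

lemma coeff_one_mul_star_F (y : α.Lc) {t : G} (a : α.D t) :
    coeff α 1 (y * star (F α t a)) = coeff α t y * star (a : A) := by
  induction y using ind with
  | h0 => simp only [zero_mul, map_zero]
  | hadd x y hx hy => simp only [add_mul, map_add, hx, hy]
  | hF s b =>
    rcases eq_or_ne s t with rfl | h
    · rw [F_mul_star_F_self, coeff_one_ofA, coeff_F_self]
    · rw [star_F, F_mul_F, coeff_F_of_ne α h, zero_mul, coeff_F_of_ne]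
      rwa [ne_eq, mul_inv_eq_one]

lemma hasSum_coeff_mul_star_coeff (x y : α.Lc) :
    HasSum (fun s => coeff α s y * star (coeff α s x)) (coeff α 1 (y * star x)) := by
  induction x using ind with
  | h0 => simpa only [map_zero, star_zero, mul_zero] using hasSum_zero
  | hadd x x' hx hx' => simpa only [map_add, star_add, mul_add] using hx.add hx'
  | hF t a =>
    rw [coeff_one_mul_star_F]
    simpa only [coeff_F_self] using hasSum_single (f := fun s => coeff α s y *
      star (coeff α s (F α t a))) t fun s hs => by rw [coeff_F_of_ne α hs.symm, star_zero, mul_zero]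

/-- The left action of `A` on `L_c` by multiplication by `F(a, e)`. -/
local instance instSMul : SMul A α.Lc := ⟨fun a x => ofA α a * x⟩

/-- The `A`-valued inner product on `L_c`, linear in the second variable and antilinear in the
first. -/
local instance instInner : Inner A α.Lc := ⟨fun x y => coeff α 1 (y * star x)⟩

/-- The Hilbert module norm `‖∑ f(s) f(s)⋆‖ ^ (1 / 2)` of `L_c`. -/
local instance instNorm : Norm α.Lc := CStarModule.norm A

lemma inner_def (x y : α.Lc) : inner A x y = coeff α 1 (y * star x) := rfl

lemma inner_mul_left (x y f : α.Lc) : inner A (x * f) y = inner A x (y * star f) := by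
  rw [inner_def, inner_def, star_mul, mul_assoc]

section Order

variable [PartialOrder A] [StarOrderedRing A]

lemma coeff_mul_star_coeff_le_inner_self (s : G) (x : α.Lc) :
    coeff α s x * star (coeff α s x) ≤ inner A x x :=
  le_hasSum (hasSum_coeff_mul_star_coeff α x x) s fun _ _ => mul_star_self_nonneg _

lemma inner_self_nonneg (x : α.Lc) : 0 ≤ inner A x x :=
  (mul_star_self_nonneg _).trans (coeff_mul_star_coeff_le_inner_self α 1 x)

/-- `L_c` is a (not necessarily complete) Hilbert module over `A`. -/
local instance instCStarModule : CStarModule A α.Lc where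
  inner_add_right := by simp only [inner_def, add_mul, map_add, implies_true]
  inner_self_nonneg {x} := inner_self_nonneg α x
  inner_self {x} := by
    refine ⟨fun h => eq_zero_of_coeff_eq_zero α fun s => ?_, fun h => ?_⟩
    · rw [← CStarRing.mul_star_self_eq_zero_iff]
      exact le_antisymm (h ▸ coeff_mul_star_coeff_le_inner_self α s x) (mul_star_self_nonneg _)
    · rw [inner_def, h, zero_mul, map_zero]
  inner_op_smul_right {a x y} := by
    change coeff α 1 (ofA α a * y * star x) = a * coeff α 1 (y * star x)
    rw [mul_assoc, coeff_ofA_mul]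
  inner_smul_right_complex := by simp only [inner_def, smul_mul_assoc, map_smul, implies_true]
  star_inner x y := by simp only [inner_def, ← coeff_one_star, star_mul, star_star]
  norm_eq_sqrt_norm_inner_self _ := rfl

local instance instNormedAddCommGroup : NormedAddCommGroup α.Lc :=
  { CStarModule.normedAddCommGroup A (E := α.Lc) with
    toAddCommGroup := inferInstanceAs (AddCommGroup α.Lc) }

local instance instNormedSpace : NormedSpace ℂ α.Lc where
  norm_smul_le c x := ((CStarModule.normedSpaceCore A (E := α.Lc)).norm_smul c x).le

lemma norm_sq_eq_norm_inner_self (x : α.Lc) : ‖x‖ ^ 2 = ‖inner A x x‖ := CStarModule.norm_sq_eq A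

lemma norm_coeff_le (s : G) (x : α.Lc) : ‖coeff α s x‖ ≤ ‖x‖ := by
  refine le_of_sq_le_sq ?_ (norm_nonneg _)
  rw [norm_sq_eq_norm_inner_self, sq, ← CStarRing.norm_self_mul_star]
  exact CStarAlgebra.norm_le_norm_of_nonneg_of_le (mul_star_self_nonneg _)
    (coeff_mul_star_coeff_le_inner_self α s x)

lemma norm_ofA (a : A) : ‖ofA α a‖ = ‖a‖ := by
  rw [← sq_eq_sq₀ (norm_nonneg _) (norm_nonneg _), norm_sq_eq_norm_inner_self, inner_def,
    ← ofA_star, ← ofA_mul, coeff_one_ofA, CStarRing.norm_self_mul_star, sq]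

lemma norm_mul_F_le (x : α.Lc) {s : G} (a : α.D s) : ‖x * F α s a‖ ≤ ‖a‖ * ‖x‖ := by
  obtain ⟨c, hc, hca⟩ := exists_isSelfAdjoint_smul_sub_mul_self (a : A)
  let k : ℂ := (‖a‖ : ℝ)
  let z : α.Lc := k • x - x * ofA α c
  have hinner : inner A (x * F α s a) (x * F α s a) = k ^ 2 • inner A x x - inner A z z := by
    have hk : star k = k := Complex.conj_ofReal _
    rw [inner_mul_left, mul_assoc, F_mul_star_F_self, ← hca]
    simp only [z, inner_def, star_sub, star_smul, star_mul, ← ofA_star, hc.star_eq, hk, sub_mul,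
      mul_sub, smul_mul_assoc, mul_smul_comm, map_sub, map_smul, ofA_mul, mul_assoc,
      Complex.ofReal_mul, Complex.ofReal_ofNat]
    change (2 * k) • _ - _ = _
    module
  refine le_of_sq_le_sq ?_ (by positivity)
  calc ‖x * F α s a‖ ^ 2 = ‖inner A (x * F α s a) (x * F α s a)‖ := norm_sq_eq_norm_inner_self α _
    _ ≤ ‖k ^ 2 • inner A x x‖ := by
      refine CStarAlgebra.norm_le_norm_of_nonneg_of_le (inner_self_nonneg α _) ?_
      rw [hinner]
      exact sub_le_self _ (inner_self_nonneg α z)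
    _ = (‖a‖ * ‖x‖) ^ 2 := by
      rw [norm_smul, norm_pow, Complex.norm_real, norm_norm, mul_pow, norm_sq_eq_norm_inner_self]

lemma exists_norm_mul_le (f : α.Lc) : ∃ C, ∀ x : α.Lc, ‖x * f‖ ≤ C * ‖x‖ := by
  induction f using ind with
  | h0 => exact ⟨0, fun x => by rw [mul_zero, norm_zero, zero_mul]⟩
  | hF s a => exact ⟨‖a‖, fun x => norm_mul_F_le α x a⟩
  | hadd f g hf hg =>
    obtain ⟨C, hC⟩ := hf
    obtain ⟨D, hD⟩ := hg
    refine ⟨C + D, fun x => ?_⟩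
    rw [mul_add, add_mul]
    exact norm_add_le_of_le (hC x) (hD x)

/-- The right action of `L_c` on itself by bounded operators of the Hilbert module `L_c`. -/
def mulRight : α.Lc →ₗ[ℂ] α.Lc →L[ℂ] α.Lc where
  toFun f := LinearMap.mkContinuousOfExistsBound (LinearMap.mulRight ℂ f) (exists_norm_mul_le α f)
  map_add' f g := ContinuousLinearMap.ext fun x => mul_add x f g
  map_smul' c f := ContinuousLinearMap.ext fun x => mul_smul_comm c x f

/-- The reduced C⋆-seminorm on `L_c`, the norm of its right regular representation. -/
def reducedSeminorm : CStarSeminorm α.Lc :=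
  .ofRightAction (A := A) (mulRight α)
    (fun f g => ContinuousLinearMap.ext fun x => (mul_assoc x f g).symm)
    fun f x y => inner_mul_left α x y f

lemma norm_coeff_le_reducedSeminorm (s : G) (f : α.Lc) :
    ‖coeff α s f‖ ≤ (reducedSeminorm α).toSeminorm f := by
  set u := coeff α s f
  rcases (norm_nonneg u).eq_or_lt with hu | hu
  · rw [← hu]
    exact apply_nonneg _ _
  refine le_of_mul_le_mul_right ?_ hu
  calc ‖u‖ * ‖u‖ = ‖coeff α s (ofA α (star u) * f)‖ := by
        rw [coeff_ofA_mul, CStarRing.norm_star_mul_self]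
    _ ≤ ‖mulRight α f (ofA α (star u))‖ := norm_coeff_le α s _
    _ ≤ ‖mulRight α f‖ * ‖ofA α (star u)‖ := (mulRight α f).le_opNorm _
    _ = ‖mulRight α f‖ * ‖u‖ := by rw [norm_ofA, norm_star]

end Order

theorem norm_coeff_le_greatest (s : G) (f : α.Lc) :
    ‖coeff α s f‖ ≤ (CStarSeminorm.greatest (bddAbove α)).toSeminorm f := by
  let _ : PartialOrder A := CStarAlgebra.spectralOrder A
  have _ : StarOrderedRing A := CStarAlgebra.spectralOrderedRing A
  exact (norm_coeff_le_reducedSeminorm α s f).trans (CStarSeminorm.le_greatest _ _ f)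

end Lc

/-- The Fourier coefficient at `s`: the extension of the evaluation `f ↦ f s` from `L_c` to the
crossed product. -/
def fourierCoeff (s : G) : α.CrossedProduct →L[ℂ] A :=
  let q := CStarSeminorm.greatest (Lc.bddAbove α)
  let evalAt : q.Pre →L[ℂ] A := LinearMap.mkContinuous (show q.Pre →ₗ[ℂ] A from Lc.coeff α s) 1
    fun f => (Lc.norm_coeff_le_greatest α s f).trans_eq (one_mul _).symm
  let toCrossedProduct : q.Pre →L[ℂ] α.CrossedProduct := UniformSpace.Completion.toComplL
  evalAt.extend toCrossedProduct

lemma fourierCoeff_F (s : G) (a : α.D s) : α.fourierCoeff s (α.F s a) = a :=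
  let q := CStarSeminorm.greatest (Lc.bddAbove α)
  let i : q.Pre →L[ℂ] α.CrossedProduct := UniformSpace.Completion.toComplL
  have hi : DenseRange i := CStarSeminorm.Completion.denseRange_of q
  have hi' : IsUniformInducing i := UniformSpace.Completion.isUniformInducing_coe q.Pre
  (ContinuousLinearMap.extend_eq _ hi hi' (Lc.F α s a)).trans (Lc.coeff_F_self α s a)

end PartialAction

section ApproximateUnit

open Filter Topology NNReal

lemma isClosed_setOf_tendsto_of_eventually_lipschitzWith {ι X Y : Type*}
    [PseudoMetricSpace X] [PseudoMetricSpace Y] {l : Filter ι} {f : ι → X → Y} {g : X → Y}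
    {K : ℝ≥0} (hf : ∀ᶠ i in l, LipschitzWith K (f i)) (hg : Continuous g) :
    IsClosed {x | Tendsto (f · x) l (𝓝 (g x))} := by
  let i : {i // LipschitzWith K (f i)} → ι := Subtype.val
  have hi : Set.range i ∈ l := Subtype.range_val.symm ▸ hf
  have hequi : Equicontinuous (f ∘ i) :=
    (LipschitzWith.uniformEquicontinuous _ K fun j => j.2).equicontinuous
  simpa only [← tendsto_comap'_iff hi] using!
    hequi.isClosed_setOfPred_tendsto (l := comap i l) hg

namespace PartialAction

variable {G A : Type*} [Group G] [NonUnitalCStarAlgebra A] (α : PartialAction G A)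

lemma ofA_mul (a b : A) : α.ofA (a * b) = α.ofA a * α.ofA b := by
  simp only [ofA_apply, ← CStarSeminorm.Completion.of_mul, Lc.ofA_mul]

variable {α}

lemma tendsto_ofA_mul_F {l : Filter A} (hl : l.IsApproximateUnit) {t : G} (b : α.D t) :
    Tendsto (fun a => α.ofA a * α.F t b) l (𝓝 (α.F t b)) := by
  simp only [ofA_mul_F]
  exact ((α.F t).continuous.tendsto b).comp (tendsto_subtype_rng.2 (hl.tendsto_mul_right b))

lemma tendsto_F_mul_ofA {l : Filter A} (hl : l.IsApproximateUnit) {t : G} (b : α.D t) :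
    Tendsto (fun a => α.F t b * α.ofA a) l (𝓝 (α.F t b)) := by
  have hα : Continuous (α.α t) := (StarAlgEquiv.isometry (α.α t)).continuous
  have ht : Tendsto (fun a : A => (⟨(α.α t).symm b * a, α.mul_mem_right t⁻¹ a (Subtype.mem _)⟩ :
      α.D t⁻¹)) l (𝓝 ((α.α t).symm b)) :=
    tendsto_subtype_rng.2 (hl.tendsto_mul_left _)
  simp only [F_mul_ofA]
  simpa only [Function.comp_def, StarAlgEquiv.apply_symm_apply] using
    (((α.F t).continuous.comp hα).tendsto _).comp ht

theorem isApproximateUnit_map_ofA {l : Filter A} (hl : l.IsApproximateUnit) {C : ℝ≥0}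
    (hC : ∀ᶠ a in l, ‖a‖₊ ≤ C) : (l.map α.ofA).IsApproximateUnit := by
  have hbound : ∀ᶠ a in l, ‖α.ofA a‖₊ ≤ ‖α.ofA‖₊ * C :=
    hC.mono fun a ha => (α.ofA.le_opNNNorm a).trans (by gcongr)
  have hleft : ∀ᶠ a in l, LipschitzWith (‖α.ofA‖₊ * C) fun x => α.ofA a * x :=
    hbound.mono fun a ha => .of_dist_le_mul fun x y => by
      rw [dist_eq_norm, dist_eq_norm, ← mul_sub]
      exact (norm_mul_le _ _).trans (by gcongr; exact ha)
  have hright : ∀ᶠ a in l, LipschitzWith (‖α.ofA‖₊ * C) fun x => x * α.ofA a :=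
    hbound.mono fun a ha => .of_dist_le_mul fun x y => by
      rw [dist_eq_norm, dist_eq_norm, ← sub_mul, mul_comm (_ : ℝ)]
      exact (norm_mul_le _ _).trans (by gcongr; exact ha)
  have htendsto (x : α.CrossedProduct) :
      Tendsto (fun a => α.ofA a * x) l (𝓝 x) ∧ Tendsto (fun a => x * α.ofA a) l (𝓝 x) := by
    refine CStarSeminorm.Completion.ind _ (P := fun x => Tendsto (fun a => α.ofA a * x) l (𝓝 x) ∧
      Tendsto (fun a => x * α.ofA a) l (𝓝 x))
      ((isClosed_setOf_tendsto_of_eventually_lipschitzWith hleft continuous_id).inter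
        (isClosed_setOf_tendsto_of_eventually_lipschitzWith hright continuous_id)) (fun f => ?_) x
    induction f using Lc.ind with
    | h0 => simp only [map_zero, mul_zero, zero_mul, tendsto_const_nhds, and_self]
    | hF t b => exact ⟨tendsto_ofA_mul_F hl b, tendsto_F_mul_ofA hl b⟩
    | hadd f g hf hg =>
      simp only [map_add, mul_add, add_mul]
      exact ⟨hf.1.add hg.1, hf.2.add hg.2⟩
  have := hl.neBot
  exact ⟨fun x => (htendsto x).2, fun x => (htendsto x).1⟩

end PartialAction

end ApproximateUnit

namespace PartialAction

open Bidual

variable {G A : Type*} [Group G] [NonUnitalCStarAlgebra A] (α : PartialAction G A)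

lemma p_eq_supportProjection (s : G) : α.p s = supportProjection (α.D s) := rfl

lemma map_fourierCoeff_ofA_mul_m (s : G) (a : A) :
    map (α.fourierCoeff s) (mul (ofElem (α.ofA a)) (α.m s)) = mul (ofElem a) (α.p s) := by
  rw [α.isM_unique (α.isM_m s), ofElem_mul_map, Bidual.map_map, p, ofElem_mul_map]
  congr 1
  ext b
  simp only [ContinuousLinearMap.comp_apply, ContinuousLinearMap.mul_apply', ofA_mul_F,
    fourierCoeff_F]
  rfl

theorem p_mem_multiplierAlgebra_of_m_mem {s : G}
    (hm : α.m s ∈ multiplierAlgebra α.CrossedProduct) : α.p s ∈ multiplierAlgebra A := by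
  rw [p_eq_supportProjection, supportProjection_mem_multiplierAlgebra_iff (α.mul_mem_left s)]
  intro a
  obtain ⟨x, hx⟩ := (hm (α.ofA a)).2
  exact ⟨α.fourierCoeff s x,
    (congrArg (map (α.fourierCoeff s)) hx).trans (α.map_fourierCoeff_ofA_mul_m s a)⟩

lemma exists_ofElem_ofA_mul_pCross_eq {s : G} (hp : α.p s ∈ multiplierAlgebra A) (a : A) :
    ∃ c : α.D s, mul (ofElem (α.ofA a)) (α.pCross s) = ofElem (α.ofA c) := by
  obtain ⟨c, hc, hac⟩ := exists_mem_ofElem_mul_supportProjection_eq (α.mul_mem_left s) hp a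
  exact ⟨⟨c, hc⟩, (Bidual.map_mul α.ofA_mul _ _).symm.trans (congrArg (map α.ofA) hac)⟩

lemma ofElem_ofA_mul_pCross (s : G) (a : A) :
    mul (ofElem (α.ofA a)) (α.pCross s) = mul (α.pCross s) (ofElem (α.ofA a)) := by
  have h := congrArg (map α.ofA) (ofElem_mul_supportProjection (α.mul_mem_left s) a)
  rwa [Bidual.map_mul α.ofA_mul, Bidual.map_mul α.ofA_mul] at h

lemma ofElem_ofA_mul_m_mem_range {s : G} (hp : α.p s ∈ multiplierAlgebra A) (a : A) :
    mul (ofElem (α.ofA a)) (α.m s) ∈ Set.range (ofElem (E := α.CrossedProduct)) := by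
  obtain ⟨c, hc⟩ := α.exists_ofElem_ofA_mul_pCross_eq hp a
  refine ⟨α.F s c, ?_⟩
  calc ofElem (α.F s c) = mul (ofElem (α.ofA c)) (α.m s) := ((α.isM_m s).mul_left c).symm
    _ = mul (ofElem (α.ofA a)) (mul (α.pCross s) (α.m s)) := by rw [← hc, Bidual.mul_assoc]
    _ = mul (ofElem (α.ofA a)) (α.m s) := by rw [(α.isM_m s).left]

lemma m_mul_ofElem_ofA_mem_range {s : G} (hp : α.p s⁻¹ ∈ multiplierAlgebra A) (a : A) :
    mul (α.m s) (ofElem (α.ofA a)) ∈ Set.range (ofElem (E := α.CrossedProduct)) := by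
  obtain ⟨c, hc⟩ := α.exists_ofElem_ofA_mul_pCross_eq hp a
  refine ⟨α.F s (α.α s c), ?_⟩
  calc ofElem (α.F s (α.α s c)) = mul (α.m s) (ofElem (α.ofA c)) :=
        ((α.isM_m s).mul_right c).symm
    _ = mul (mul (α.m s) (α.pCross s⁻¹)) (ofElem (α.ofA a)) := by
        rw [← hc, ofElem_ofA_mul_pCross, Bidual.mul_assoc]
    _ = mul (α.m s) (ofElem (α.ofA a)) := by rw [(α.isM_m s).right]

theorem m_mem_multiplierAlgebra {s : G} (hp : α.p s ∈ multiplierAlgebra A)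
    (hp' : α.p s⁻¹ ∈ multiplierAlgebra A) : α.m s ∈ multiplierAlgebra α.CrossedProduct := by
  let _ : PartialOrder A := CStarAlgebra.spectralOrder A
  have _ : StarOrderedRing A := CStarAlgebra.spectralOrderedRing A
  have hl := CStarAlgebra.increasingApproximateUnit A
  exact mem_multiplierAlgebra_of_isApproximateUnit
    (isApproximateUnit_map_ofA hl.toIsApproximateUnit hl.eventually_nnnorm)
    (Filter.eventually_map.2 (.of_forall fun a =>
      ⟨α.m_mul_ofElem_ofA_mem_range hp' a, α.ofElem_ofA_mul_m_mem_range hp a⟩))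

end PartialAction

end

theorem mainTheorem11 {G A : Type*} [Group G] [NonUnitalCStarAlgebra A]
    (α : PartialAction G A) (s : G) :
    (α.p s ∈ multiplierAlgebra A ↔
      Bidual.ofElem '' (α.D s : Set A) =
        Set.range fun a : A => Bidual.mul (Bidual.ofElem a) (α.p s)) ∧
    (α.p s ∈ multiplierAlgebra A ↔
      Bidual.map (α.incl s) '' multiplierAlgebra (α.D s) ⊆ multiplierAlgebra A) ∧
    (α.m s ∈ multiplierAlgebra α.CrossedProduct → α.p s ∈ multiplierAlgebra A) ∧
    (α.p s ∈ multiplierAlgebra A → α.p s⁻¹ ∈ multiplierAlgebra A →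
      α.m s ∈ multiplierAlgebra α.CrossedProduct) :=
  ⟨Bidual.supportProjection_mem_multiplierAlgebra_iff_image_eq_range (α.mul_mem_left s),
    Bidual.supportProjection_mem_multiplierAlgebra_iff_image_subset (α.mul_mem_left s),
    α.p_mem_multiplierAlgebra_of_m_mem, α.m_mem_multiplierAlgebra⟩
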